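/- Let $G$ be a graph on a finite vertex set $V$, $|V|=p$, with a clique forest: a finite family $\mathcal C$ of cliques of $G$ arranged as the nodes of a forest, such that two distinct vertices are adjacent in $G$ iff they lie in a common clique of $\mathcal C$, and such that for every vertex the cliques containing it form a nonempty connected subgraph of the forest. Let $\mathcal S$ be the family of separators $c\cap c'$, one for each edge $\{c,c'\}$ of the forest (so counted with multiplicity). Let $\Theta$ be the set of pairs $(\mu,J)$ with $\mu\in\mathbb R^V$ and $J$ a symmetric positive definite $V\times V$ matrix with $J_{ij}=0$ whenever $i\ne j$ are not adjacent in $G$. Let $\nu>2$, let $x(1),\dots,x(q)\in\mathbb R^V$ with $q\ge1$, and for $(\mu,J)\in\Theta$ put $d^2_s=(x(s)-\mu)^{\mathsf T}J(x(s)-\mu)$. The Student-t log-likelihood with inverse covariance $J$ is $$\ell(\mu,J)=q\log\frac{\Gamma(\frac{\nu+p}2)}{((\nu-2)\pi)^{p/2}\,\Gamma(\frac\nu2)}+\frac q2\log|J|-\frac{\nu+p}2\sum_{s=1}^q\log\Bigl(1+\frac{d_s^2}{\nu-2}\Bigr).$$ For $\theta=(\mu,J)\in\Theta$ let $f(y,z\mid\theta)$,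 $z>0$, be the density of the Gamma distribution (shape $\frac\nu2$, rate $\frac\nu2$) at $z$ times the normal density at $y$ with mean $\mu$ and inverse covariance $\frac{\nu}{\nu-2}zJ$; let $f(z\mid y,\theta)=f(y,z\mid\theta)/\int_0^\infty f(y,u\mid\theta)\,du$, and let $Q(\eta\mid\theta)=\sum_s\int_0^\infty f(z\mid x(s),\theta)\log f(x(s),z\mid\eta)\,dz$ for $\eta\in\Theta$. An EM update of $\theta=(\mu,J)\in\Theta$ is either a maximizer $\theta'\in\Theta$ of $Q(\cdot\mid\theta)$ (joint update), or a $\theta'=(\mu',J')\in\Theta$ such that $\mu'$ maximizes $Q((\cdot,J')\mid\theta)$ and $J'$ maximizes $Q((\mu,\cdot)\mid\theta)$ over the admissible matrices (separate update). An EM sequence is a sequence in $\Theta$ each term of which is an EM update, of either kind, of the preceding one. For $\theta=(\mu,J)\in\Theta$ write $$w_s(\theta)=\frac{\nu+p}{\nu+\frac{\nu}{\nu-2}d_s^2},\qquad m(\theta)=\frac{\sum_sw_s(\theta)x(s)}{\sum_sw_s(\theta)},\qquad \Sigma_{ij}(\theta,a)=\frac{\nu}{\nu-2}\,\frac1q\sum_{s=1}^qw_s(\theta)(x_i(s)-a_i)(x_j(s)-a_j).$$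 For a $V\times V$ matrix $\Sigma$ write $L(\Sigma)_{ij}=\sum_{c\in\mathcal C}(\Sigma_c^{-1})_{ij}-\sum_{s\in\mathcal S}(\Sigma_s^{-1})_{ij}$, where $\Sigma_c$ is the principal submatrix on $c$ and its inverse is extended by zero outside $c\times c$. Say that $\theta^*=(\mu^*,J^*)\in\Theta$ satisfies (E) if, with $w^*_s=w_s(\theta^*)$ and $\Sigma^*=\Sigma(\theta^*,\mu^*)$, that is $\Sigma^*_{ij}=\frac{\nu}{\nu-2}\frac1q\sum_sw^*_s(x_i(s)-\mu^*_i)(x_j(s)-\mu^*_j)$: $\mu^*=\sum_sw^*_sx(s)/\sum_sw^*_s$; all $\Sigma^*_c$ $(c\in\mathcal C)$ and $\Sigma^*_s$ $(s\in\mathcal S)$ are positive definite; and $$J^*_{ij}=\sum_{c\in\mathcal C}(\Sigma_c^{*-1})_{ij}-\sum_{s\in\mathcal S}(\Sigma_s^{*-1})_{ij}\ \text{ if } i,j \text{ lie in a common clique of }\mathcal C,\qquad J^*_{ij}=0\ \text{ otherwise.}$$ Then: 1. Every maximum likelihood solution, i.e. every maximizer $(\mu^*,J^*)$ of $\ell$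 over $\Theta$, satisfies (E), and it is a joint and a separate EM update of itself. 2. For every $\theta\in\Theta$ the EM weight $\int_0^\infty z\,f(z\mid x(s),\theta)\,dz$ equals $w_s(\theta)$ (and likewise with any $y\in\mathbb R^V$ in place of $x(s)$). 3. For $\theta\in\Theta$ the following are equivalent: $\theta$ satisfies (E); $\theta$ is a stationary point of $\ell$ on $\Theta$ (all derivatives in directions $(h,H)$ with $H$ symmetric and $H_{ij}=0$ for non-adjacent $i\neq j$ exist and vanish); $\theta$ is a joint EM update of itself; $\theta$ is a separate EM update of itself. 4. If for every clique $c\in\mathcal C$ the (unweighted) sample covariance of the variables in $c$ is positive definite, then every $\theta=(\mu,J)\in\Theta$ has exactly one joint EM update, namely $(m(\theta),L(\Sigma(\theta,m(\theta))))$, and exactly one separate EM update, namely $(m(\theta),L(\Sigma(\theta,\mu)))$. 5. Along every EM sequence $(\theta^t)$ the log-likelihood is non-decreasing. Every cluster point of $(\theta^t)$ in $\Theta$ satisfies (E). If $\theta^t\to\theta^*\in\Theta$, then $\theta^*$ satisfies (E) and the EM weights at $\theta^t$ converge to $w_s(\theta^*)$ for each $s$. If $(\theta^t)$ stays in a compact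 set $K\subseteq\Theta$ that contains only finitely many solutions of (E), then $(\theta^t)$ converges to a solution of (E) in $K$. -/

import Mathlib

open MeasureTheory Filter Topology

noncomputable section

namespace SparseStudent

/-- A clique forest of a graph `G`: a family of cliques `C i`, arranged as the vertices of a forest,
such that the edges of `G` are exactly the pairs of distinct vertices lying in a common `C i`, and
such that the cliques containing a given vertex form a (nonempty) connected part of the forest.
Maximality of the cliques is not required. A graph with such a structure is chordal. -/
structure CliqueForest {V : Type*} (G : SimpleGraph V) (ι : Type*) where
  /-- the cliques -/
  C : ι → Finset V
  /-- the forest structure on the cliques -/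
  T : SimpleGraph ι
  acyclic : T.IsAcyclic
  adj_iff : ∀ a b, G.Adj a b ↔ a ≠ b ∧ ∃ i, a ∈ C i ∧ b ∈ C i
  connected : ∀ v, (T.induce {i | v ∈ C i}).Connected

section

variable {V ι : Type*} [Fintype V] [DecidableEq V] [Fintype ι] {q : ℕ}

/-- The separator attached to an edge of the forest: the intersection of its two cliques. -/
def CliqueForest.sep {G : SimpleGraph V} (F : CliqueForest G ι) : Sym2 ι → Finset V :=
  Sym2.lift ⟨fun i j => F.C i ∩ F.C j, fun i j => Finset.inter_comm (F.C i) (F.C j)⟩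

/-- The principal submatrix on the index set `c`. -/
def block (S : Matrix V V ℝ) (c : Finset V) : Matrix c c ℝ :=
  S.submatrix (fun i => (i : V)) (fun i => (i : V))

/-- The local inverse: the inverse of the principal submatrix on `c`, placed at the positions
`c × c` and extended by zero. -/
def localInv (S : Matrix V V ℝ) (c : Finset V) : Matrix V V ℝ := fun i j =>
  if h : i ∈ c ∧ j ∈ c then (block S c)⁻¹ ⟨i, h.1⟩ ⟨j, h.2⟩ else 0

open Classical in
/-- Sum of the local inverses over the cliques minus the sum over the separators, the latter
counted with multiplicity (one term for each edge of the forest). -/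
def cliqueMinusSep {G : SimpleGraph V} (F : CliqueForest G ι) (S : Matrix V V ℝ) : Matrix V V ℝ :=
  fun i j => ∑ k, localInv S (F.C k) i j - ∑ e ∈ F.T.edgeFinset, localInv S (F.sep e) i j

/-- Parameters `(μ, J)`: `J` is positive definite and its off-diagonal entries vanish off the
edges of `G`. -/
def params (G : SimpleGraph V) : Set ((V → ℝ) × Matrix V V ℝ) :=
  {θ | θ.2.PosDef ∧ ∀ i j, i ≠ j → ¬ G.Adj i j → θ.2 i j = 0}

/-- Square of the Mahalanobis distance of `y` from the location, for `θ = (μ, J)`. -/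
def mahalanobisSq (θ : (V → ℝ) × Matrix V V ℝ) (y : V → ℝ) : ℝ :=
  (y - θ.1) ⬝ᵥ (θ.2.mulVec (y - θ.1))

/-- Log-likelihood of the multivariate Student-t with `ν` degrees of freedom, location `μ` and
inverse covariance `J`, for the observations `x 0, …, x (q-1)`. -/
def logLik (ν : ℝ) (x : Fin q → V → ℝ) (θ : (V → ℝ) × Matrix V V ℝ) : ℝ :=
  (q : ℝ) * Real.log (Real.Gamma ((ν + Fintype.card V) / 2) /
      ((ν - 2) ^ ((Fintype.card V : ℝ) / 2) * Real.pi ^ ((Fintype.card V : ℝ) / 2)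
        * Real.Gamma (ν / 2)))
    + (q : ℝ) / 2 * Real.log θ.2.det
    - (ν + Fintype.card V) / 2 * ∑ s, Real.log (1 + 1 / (ν - 2) * mahalanobisSq θ (x s))

/-- Maximum likelihood solution of the sparse Student-t problem. -/
def IsMLSolution (G : SimpleGraph V) (ν : ℝ) (x : Fin q → V → ℝ)
    (θ : (V → ℝ) × Matrix V V ℝ) : Prop :=
  θ ∈ params G ∧ ∀ η ∈ params G, logLik ν x η ≤ logLik ν x θ

/-- Stationary point of the log-likelihood: all derivatives in the directions allowed by the
sparsity constraint vanish. -/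
def IsStationary (G : SimpleGraph V) (ν : ℝ) (x : Fin q → V → ℝ)
    (θ : (V → ℝ) × Matrix V V ℝ) : Prop :=
  ∀ (h : V → ℝ) (H : Matrix V V ℝ), H.IsSymm → (∀ i j, i ≠ j → ¬ G.Adj i j → H i j = 0) →
    HasDerivAt (fun t : ℝ => logLik ν x (θ.1 + t • h, θ.2 + t • H)) 0 0

/-! ### The expectation-maximization iteration -/

/-- Normal density with location `μ` and inverse covariance `(ν / (ν - 2)) z J`. -/
def normalDensity (ν : ℝ) (θ : (V → ℝ) × Matrix V V ℝ) (y : V → ℝ) (z : ℝ) : ℝ :=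
  Real.sqrt (z ^ Fintype.card V * ν ^ Fintype.card V * θ.2.det /
      (2 * Real.pi * (ν - 2)) ^ Fintype.card V)
    * Real.exp (-(z / 2 * (ν / (ν - 2)) * mahalanobisSq θ y))

/-- Joint density of the observation `y` and the latent mixing variable `z`. -/
def jointDensity (ν : ℝ) (θ : (V → ℝ) × Matrix V V ℝ) (y : V → ℝ) (z : ℝ) : ℝ :=
  ProbabilityTheory.gammaPDFReal (ν / 2) (ν / 2) z * normalDensity ν θ y z

/-- Conditional density of the latent variable `z` given the observation `y`. -/
def posterior (ν : ℝ) (θ : (V → ℝ) × Matrix V V ℝ) (y : V → ℝ) (z : ℝ) : ℝ :=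
  jointDensity ν θ y z / ∫ u in Set.Ioi (0 : ℝ), jointDensity ν θ y u

/-- The expectation `Q(η | θ)` of the E-step. -/
def emQ (ν : ℝ) (x : Fin q → V → ℝ) (η θ : (V → ℝ) × Matrix V V ℝ) : ℝ :=
  ∑ s, ∫ z in Set.Ioi (0 : ℝ), posterior ν θ (x s) z * Real.log (jointDensity ν η (x s) z)

/-- The EM weight of an observation: the conditional mean of the latent variable. -/
def emWeight (ν : ℝ) (θ : (V → ℝ) × Matrix V V ℝ) (y : V → ℝ) : ℝ :=
  ∫ z in Set.Ioi (0 : ℝ), z * posterior ν θ y z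

/-- EM update with a joint M-step: `θ'` maximizes `Q(· | θ)` over all parameters. -/
def IsEMStep (G : SimpleGraph V) (ν : ℝ) (x : Fin q → V → ℝ)
    (θ θ' : (V → ℝ) × Matrix V V ℝ) : Prop :=
  θ' ∈ params G ∧ ∀ η ∈ params G, emQ ν x η θ ≤ emQ ν x θ' θ

/-- EM update with a separate M-step: the new location maximizes `Q(· | θ)` in the location
argument, and the new `J` maximizes `Q(· | θ)` in the `J` argument with the location kept at its
current value. -/
def IsSeparateEMStep (G : SimpleGraph V) (ν : ℝ) (x : Fin q → V → ℝ)
    (θ θ' : (V → ℝ) × Matrix V V ℝ) : Prop :=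
  θ' ∈ params G ∧ (∀ m, emQ ν x (m, θ'.2) θ ≤ emQ ν x θ' θ) ∧
    ∀ η ∈ params G, emQ ν x (θ.1, η.2) θ ≤ emQ ν x (θ.1, θ'.2) θ

/-- A run of the EM iteration; each M-step may be joint or separate. -/
def IsEMSequence (G : SimpleGraph V) (ν : ℝ) (x : Fin q → V → ℝ)
    (θ : ℕ → (V → ℝ) × Matrix V V ℝ) : Prop :=
  θ 0 ∈ params G ∧
    ∀ t, IsEMStep G ν x (θ t) (θ (t + 1)) ∨ IsSeparateEMStep G ν x (θ t) (θ (t + 1))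

/-! ### The closed forms -/

/-- The explicit weight `(ν + p) / (ν + (ν / (ν - 2)) d²)`. -/
def studentWeight (ν : ℝ) (θ : (V → ℝ) × Matrix V V ℝ) (y : V → ℝ) : ℝ :=
  (ν + Fintype.card V) / (ν + ν / (ν - 2) * mahalanobisSq θ y)

/-- Weighted mean of the observations. -/
def weightedMean (w : Fin q → ℝ) (x : Fin q → V → ℝ) : V → ℝ :=
  (∑ s, w s)⁻¹ • ∑ s, w s • x s

/-- Weighted sample covariance `(1/q) ∑ₛ wₛ (xᵢ(s) - mᵢ)(xⱼ(s) - mⱼ)` around `m`. -/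
def weightedCov (w : Fin q → ℝ) (x : Fin q → V → ℝ) (m : V → ℝ) : Matrix V V ℝ :=
  fun i j => 1 / (q : ℝ) * ∑ s, w s * ((x s i - m i) * (x s j - m j))

/-- The covariance estimator `(ν / (ν - 2)) (1/q) ∑ₛ wₛ (xᵢ(s) - mᵢ)(xⱼ(s) - mⱼ)`, with the
weights `wₛ` computed at the parameter `θ`. -/
def emCov (ν : ℝ) (x : Fin q → V → ℝ) (θ : (V → ℝ) × Matrix V V ℝ) (m : V → ℝ) : Matrix V V ℝ :=
  (ν / (ν - 2)) • weightedCov (fun s => studentWeight ν θ (x s)) x m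

/-- The self-consistent equations for `θ = (μ*, J*)`, with weights `w*` and covariances `Σ*`
computed at `θ` itself. -/
structure SolvesEquations {G : SimpleGraph V} (F : CliqueForest G ι) (ν : ℝ) (x : Fin q → V → ℝ)
    (θ : (V → ℝ) × Matrix V V ℝ) : Prop where
  mean_eq : θ.1 = weightedMean (fun s => studentWeight ν θ (x s)) x
  clique_posDef : ∀ k, (block (emCov ν x θ θ.1) (F.C k)).PosDef
  sep_posDef : ∀ e ∈ F.T.edgeSet, (block (emCov ν x θ θ.1) (F.sep e)).PosDef
  entry_eq : ∀ i j, (∃ k, i ∈ F.C k ∧ j ∈ F.C k) →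
    θ.2 i j = cliqueMinusSep F (emCov ν x θ θ.1) i j
  entry_zero : ∀ i j, (¬ ∃ k, i ∈ F.C k ∧ j ∈ F.C k) → θ.2 i j = 0

end

end SparseStudent

end

/-!
Given an observation, the latent variable is again Gamma distributed, so up to a constant
`Q(· | θ)` is the Gaussian log-likelihood of the reweighted data. Its maximizer in the location is
the weighted mean. Its maximizer in `J`, for a given location, is the sparse positive definite
matrix whose inverse agrees with the weighted covariance on the diagonal and on the edges of `G`.
On a clique forest this matrix is explicit: adding a leaf clique whose separator is `s` amounts to
regressing its new variables on those in `s`, which adds the inverse of the clique block to the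
precision matrix and subtracts that of the block of `s`.

Concavity of `log` makes `Q(· | θ) - Q(θ | θ)` a minorant of `ℓ - ℓ(θ)` that touches it to first
order at `θ`. Hence a maximizer of `ℓ` is a fixed point of the EM iteration, and the fixed points
are the stationary points. Along an EM sequence `ℓ` increases, so its increments vanish along an
ultrafilter converging in `Θ`; the minorant then makes the limit a fixed point, and by continuity of
the explicit update the next terms have the same limit. A sequence in a compact set with this
property and finitely many limit points cannot leave a neighbourhood of one of them infinitely
often, so it converges.
-/

noncomputable section

namespace SparseStudent

open Matrix ProbabilityTheory

section LocalInverse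

variable {V : Type*}

lemma isSymm_of_posDef {M : Matrix V V ℝ} (hM : M.PosDef) : M.IsSymm :=
  isHermitian_iff_isSymm.1 hM.isHermitian

lemma block_posDef_of_subset {S : Matrix V V ℝ} {c s : Finset V} (hs : s ⊆ c)
    (h : (block S c).PosDef) : (block S s).PosDef :=
  h.submatrix (Set.inclusion_injective hs)

variable [DecidableEq V]

/-- The `c × V` matrix restricting a vector to the coordinates in `c`. -/
def coordSel (c : Finset V) : Matrix c V ℝ := (1 : Matrix V V ℝ).submatrix (fun i => (i : V)) id

/-- The diagonal projector onto the coordinates in `c`. -/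
def coordProj (c : Finset V) : Matrix V V ℝ := diagonal fun i => if i ∈ c then 1 else 0

lemma coordProj_transpose (c : Finset V) : (coordProj c)ᵀ = coordProj c :=
  diagonal_transpose _

lemma coordProj_empty : coordProj (∅ : Finset V) = 0 := by simp [coordProj]

lemma coordProj_add_of_disjoint {c d : Finset V} (h : Disjoint c d) :
    coordProj c + coordProj d = coordProj (c ∪ d) := by
  simp only [coordProj, diagonal_add]
  congr 1
  ext i
  by_cases hi : i ∈ c
  · simp [hi, Finset.disjoint_left.1 h hi]
  · simp [hi]

lemma coordProj_add_sdiff {c s : Finset V} (h : s ⊆ c) :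
    coordProj s + coordProj (c \ s) = coordProj c := by
  rw [coordProj_add_of_disjoint Finset.disjoint_sdiff, Finset.union_sdiff_of_subset h]

lemma localInv_empty (S : Matrix V V ℝ) : localInv S ∅ = 0 := by
  ext i j
  simp [localInv]

lemma localInv_apply_eq_zero (S : Matrix V V ℝ) {c : Finset V} {i j : V}
    (h : ¬ (i ∈ c ∧ j ∈ c)) : localInv S c i j = 0 := dif_neg h

lemma coordSel_transpose_mul_mul (c : Finset V) (A : Matrix c c ℝ) (i j : V) :
    ((coordSel c)ᵀ * A * coordSel c) i j =
      if h : i ∈ c ∧ j ∈ c then A ⟨i, h.1⟩ ⟨j, h.2⟩ else 0 := by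
  by_cases hi : i ∈ c <;> by_cases hj : j ∈ c
  · lift i to c using hi
    lift j to c using hj
    simp [coordSel, mul_apply, one_apply]
  all_goals
    have hne : ∀ a ∈ c, ∀ b ∉ c, a ≠ b := fun a ha b hb h => hb (h ▸ ha)
    simp +contextual [coordSel, mul_apply, one_apply, hi, hj, hne, (hne _ _ _ _).symm]

lemma coordSel_transpose_mul (c : Finset V) : (coordSel c)ᵀ * coordSel c = coordProj c := by
  ext i j
  rw [← Matrix.mul_one (coordSel c)ᵀ, coordSel_transpose_mul_mul, coordProj, diagonal_apply]
  by_cases hi : i ∈ c <;> by_cases hij : i = j <;> simp_all [one_apply]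

lemma localInv_eq (S : Matrix V V ℝ) (c : Finset V) :
    localInv S c = (coordSel c)ᵀ * (block S c)⁻¹ * coordSel c := by
  ext i j
  rw [coordSel_transpose_mul_mul, localInv]

lemma localInv_transpose {S : Matrix V V ℝ} (hS : S.IsSymm) (c : Finset V) :
    (localInv S c)ᵀ = localInv S c := by
  have hblock : (block S c)ᵀ = block S c := by rw [block, transpose_submatrix, hS.eq]
  rw [localInv_eq, transpose_mul, transpose_mul, transpose_transpose, transpose_nonsing_inv,
    hblock, Matrix.mul_assoc]

lemma localInv_posSemidef [Finite V] {S : Matrix V V ℝ} {c : Finset V} (h : (block S c).PosDef) :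
    (localInv S c).PosSemidef := by
  rw [localInv_eq]
  exact h.inv.posSemidef.conjTranspose_mul_mul_same (coordSel c)

variable [Fintype V]

lemma coordProj_univ : coordProj (Finset.univ : Finset V) = 1 := by simp [coordProj]

lemma one_sub_coordProj (c : Finset V) : 1 - coordProj c = coordProj cᶜ := by
  rw [sub_eq_iff_eq_add', coordProj_add_of_disjoint disjoint_compl_right, Finset.union_compl,
    coordProj_univ]

lemma coordProj_mul_coordProj (c d : Finset V) :
    coordProj c * coordProj d = coordProj (c ∩ d) := by
  simp only [coordProj, diagonal_mul_diagonal, Finset.mem_inter, ite_and, ite_mul, one_mul,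
    zero_mul]

lemma coordProj_mul_eq_zero {c d : Finset V} (h : Disjoint c d) :
    coordProj c * coordProj d = 0 := by
  rw [coordProj_mul_coordProj, Finset.disjoint_iff_inter_eq_empty.1 h, coordProj_empty]

lemma coordProj_mul_self (c : Finset V) : coordProj c * coordProj c = coordProj c := by
  rw [coordProj_mul_coordProj, Finset.inter_self]

lemma coordProj_mul_of_subset {c d : Finset V} (h : c ⊆ d) :
    coordProj c * coordProj d = coordProj c := by
  rw [coordProj_mul_coordProj, Finset.inter_eq_left.2 h]

lemma coordProj_mul_of_superset {c d : Finset V} (h : d ⊆ c) :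
    coordProj c * coordProj d = coordProj d := by
  rw [coordProj_mul_coordProj, Finset.inter_eq_right.2 h]

lemma coordProj_mul_mul_coordProj_apply (c : Finset V) (A : Matrix V V ℝ) (i j : V) :
    (coordProj c * A * coordProj c) i j = if i ∈ c ∧ j ∈ c then A i j else 0 := by
  rw [coordProj, mul_diagonal, diagonal_mul]
  by_cases hi : i ∈ c <;> by_cases hj : j ∈ c <;> simp [hi, hj]

lemma coordProj_mul_mul_coordProj_eq_iff (c : Finset V) (A B : Matrix V V ℝ) :
    coordProj c * A * coordProj c = coordProj c * B * coordProj c ↔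
      ∀ i ∈ c, ∀ j ∈ c, A i j = B i j := by
  simp only [← Matrix.ext_iff, coordProj_mul_mul_coordProj_apply]
  refine ⟨fun h i hi j hj => by simpa only [hi, hj, and_self, if_true] using h i j,
    fun h i j => ?_⟩
  split_ifs with hij
  · exact h i hij.1 j hij.2
  · rfl

lemma coordSel_mul_transpose (c : Finset V) : coordSel c * (coordSel c)ᵀ = 1 := by
  ext i j
  simp [coordSel, mul_apply, one_apply, eq_comm]

lemma block_eq (S : Matrix V V ℝ) (c : Finset V) :
    block S c = coordSel c * S * (coordSel c)ᵀ := by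
  ext i j
  simp [block, coordSel, mul_apply, one_apply]

lemma coordProj_mul_localInv (S : Matrix V V ℝ) (c : Finset V) :
    coordProj c * localInv S c = localInv S c := by
  simp only [localInv_eq, ← coordSel_transpose_mul, Matrix.mul_assoc]
  rw [← Matrix.mul_assoc (coordSel c), coordSel_mul_transpose, Matrix.one_mul]

lemma localInv_mul_coordProj (S : Matrix V V ℝ) (c : Finset V) :
    localInv S c * coordProj c = localInv S c := by
  simp only [localInv_eq, ← coordSel_transpose_mul, Matrix.mul_assoc]
  rw [← Matrix.mul_assoc (coordSel c), coordSel_mul_transpose, Matrix.one_mul]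

lemma localInv_mul_coordProj_eq_zero (S : Matrix V V ℝ) {c d : Finset V} (h : Disjoint c d) :
    localInv S c * coordProj d = 0 := by
  rw [← localInv_mul_coordProj, Matrix.mul_assoc, coordProj_mul_eq_zero h, Matrix.mul_zero]

lemma coordProj_mul_localInv_eq_zero (S : Matrix V V ℝ) {c d : Finset V} (h : Disjoint d c) :
    coordProj d * localInv S c = 0 := by
  rw [← coordProj_mul_localInv, ← Matrix.mul_assoc, coordProj_mul_eq_zero h, Matrix.zero_mul]

lemma localInv_mul_mul_coordProj {S : Matrix V V ℝ} {c : Finset V} (h : (block S c).PosDef) :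
    localInv S c * S * coordProj c = coordProj c :=
  calc localInv S c * S * coordProj c
      = (coordSel c)ᵀ * ((block S c)⁻¹ * (coordSel c * S * (coordSel c)ᵀ)) * coordSel c := by
        simp only [localInv_eq, ← coordSel_transpose_mul, Matrix.mul_assoc]
    _ = coordProj c := by
        rw [← block_eq, nonsing_inv_mul _ h.det_pos.ne'.isUnit, Matrix.mul_one,
          coordSel_transpose_mul]

lemma coordProj_mul_mul_localInv {S : Matrix V V ℝ} (hS : S.IsSymm) {c : Finset V}
    (h : (block S c).PosDef) : coordProj c * S * localInv S c = coordProj c := by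
  simpa only [transpose_mul, coordProj_transpose, localInv_transpose hS, hS.eq,
    Matrix.mul_assoc] using congrArg transpose (localInv_mul_mul_coordProj h)

end LocalInverse

section Gluing

variable {V : Type*} [Fintype V] [DecidableEq V]

/-- The coefficients of the linear regression of the coordinates in `c \ s` on the coordinates
in `s`, for a covariance matrix `S`. -/
def regression (S : Matrix V V ℝ) (c s : Finset V) : Matrix V V ℝ :=
  coordProj (c \ s) * S * localInv S s

/-- The covariance of the coordinates in `c \ s` conditional on those in `s` (a Schur
complement), extended by zero. -/
def residualCov (S : Matrix V V ℝ) (c s : Finset V) : Matrix V V ℝ :=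
  coordProj (c \ s) * (S - S * localInv S s * S) * coordProj (c \ s)

/-- The precision matrix obtained from `M`, which is thought of as the identity on `c \ s`, by
attaching the clique `c` to it along the separator `s ⊆ c` with covariance `S`. -/
def glue (M S : Matrix V V ℝ) (c s : Finset V) : Matrix V V ℝ :=
  M - coordProj (c \ s) + localInv S c - localInv S s

variable {M S : Matrix V V ℝ} {c s : Finset V}

lemma coordProj_sdiff_mul_regression :
    coordProj (c \ s) * regression S c s = regression S c s := by
  rw [regression, ← Matrix.mul_assoc, ← Matrix.mul_assoc, coordProj_mul_self]

lemma regression_mul_coordProj : regression S c s * coordProj s = regression S c s := by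
  rw [regression, Matrix.mul_assoc, localInv_mul_coordProj]

lemma regression_mul_coordProj_sdiff : regression S c s * coordProj (c \ s) = 0 := by
  rw [regression, Matrix.mul_assoc, localInv_mul_coordProj_eq_zero S Finset.disjoint_sdiff,
    Matrix.mul_zero]

lemma regression_mul_self : regression S c s * regression S c s = 0 := by
  rw [← coordProj_sdiff_mul_regression, ← Matrix.mul_assoc, Matrix.mul_assoc _ _ (coordProj _),
    regression_mul_coordProj_sdiff, Matrix.mul_zero, Matrix.zero_mul]

lemma regression_transpose (hS : S.IsSymm) :
    (regression S c s)ᵀ = localInv S s * S * coordProj (c \ s) := by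
  rw [regression, transpose_mul, transpose_mul, coordProj_transpose, localInv_transpose hS, hS.eq,
    Matrix.mul_assoc]

lemma localInv_mul_mul_localInv_of_subset (hsc : s ⊆ c) (hc : (block S c).PosDef) :
    localInv S c * S * localInv S s = localInv S s := by
  rw [← coordProj_mul_localInv S s, ← coordProj_mul_of_superset hsc,
    Matrix.mul_assoc (coordProj c), coordProj_mul_localInv, ← Matrix.mul_assoc,
    localInv_mul_mul_coordProj hc]

lemma localInv_sub_localInv_eq_mul (hS : S.IsSymm) (hsc : s ⊆ c) (hc : (block S c).PosDef) :
    localInv S c - localInv S s = localInv S c * coordProj (c \ s) * (1 - regression S c s) := by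
  have hs := block_posDef_of_subset hsc hc
  have hregr : localInv S c * regression S c s = localInv S s - localInv S c * coordProj s :=
    calc localInv S c * regression S c s
        = localInv S c * (coordProj c - coordProj s) * S * localInv S s := by
          rw [← coordProj_add_sdiff hsc, add_sub_cancel_left]
          simp only [regression, Matrix.mul_assoc]
      _ = localInv S c * S * localInv S s - localInv S c * (coordProj s * S * localInv S s) := by
          rw [Matrix.mul_sub, localInv_mul_coordProj]
          simp only [Matrix.sub_mul, Matrix.mul_assoc]
      _ = localInv S s - localInv S c * coordProj s := by
          rw [localInv_mul_mul_localInv_of_subset hsc hc, coordProj_mul_mul_localInv hS hs]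
  rw [Matrix.mul_sub, Matrix.mul_one, Matrix.mul_assoc, coordProj_sdiff_mul_regression, hregr,
    sub_sub_eq_add_sub, ← Matrix.mul_add, add_comm (coordProj _), coordProj_add_sdiff hsc,
    localInv_mul_coordProj]

lemma localInv_sub_localInv_eq_conj (hS : S.IsSymm) (hsc : s ⊆ c) (hc : (block S c).PosDef) :
    localInv S c - localInv S s = (1 - regression S c s)ᵀ *
      (coordProj (c \ s) * localInv S c * coordProj (c \ s)) * (1 - regression S c s) := by
  have hmul := localInv_sub_localInv_eq_mul hS hsc hc
  have hmul_transpose : localInv S c - localInv S s =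
      (1 - regression S c s)ᵀ * coordProj (c \ s) * localInv S c := by
    simpa only [transpose_mul, transpose_sub, localInv_transpose hS, coordProj_transpose,
      Matrix.mul_assoc] using congrArg transpose hmul
  have hzero : coordProj (c \ s) * localInv S s = 0 :=
    coordProj_mul_localInv_eq_zero S Finset.sdiff_disjoint
  calc localInv S c - localInv S s
      = (1 - regression S c s)ᵀ * coordProj (c \ s) * (localInv S c - localInv S s) := by
        rw [Matrix.mul_sub, ← hmul_transpose, Matrix.mul_assoc, hzero, Matrix.mul_zero, sub_zero]
    _ = _ := by
        rw [hmul]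
        simp only [Matrix.mul_assoc]

lemma sub_coordProj_eq_conj (hM : M.IsSymm) (hMR : M * coordProj (c \ s) = coordProj (c \ s)) :
    M - coordProj (c \ s) =
      (1 - regression S c s)ᵀ * (M - coordProj (c \ s)) * (1 - regression S c s) := by
  have hmul : (M - coordProj (c \ s)) * (1 - regression S c s) = M - coordProj (c \ s) := by
    rw [Matrix.mul_sub, Matrix.mul_one, ← coordProj_sdiff_mul_regression, ← Matrix.mul_assoc,
      Matrix.sub_mul, hMR, coordProj_mul_self, sub_self, Matrix.zero_mul, sub_zero]
  rw [Matrix.mul_assoc, hmul]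
  simpa only [transpose_mul, transpose_sub, hM.eq, coordProj_transpose] using
    congrArg transpose hmul.symm

lemma glue_eq_conj (hS : S.IsSymm) (hsc : s ⊆ c) (hc : (block S c).PosDef) (hM : M.IsSymm)
    (hMR : M * coordProj (c \ s) = coordProj (c \ s)) :
    glue M S c s = (1 - regression S c s)ᵀ *
      (M - coordProj (c \ s) + coordProj (c \ s) * localInv S c * coordProj (c \ s)) *
      (1 - regression S c s) := by
  rw [Matrix.mul_add, Matrix.add_mul, ← sub_coordProj_eq_conj hM hMR,
    ← localInv_sub_localInv_eq_conj hS hsc hc, glue, add_sub_assoc]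

lemma residualCov_eq :
    residualCov S c s = coordProj (c \ s) * (1 - regression S c s) * S * coordProj (c \ s) := by
  rw [residualCov, Matrix.mul_sub (coordProj _) 1, coordProj_sdiff_mul_regression, regression]
  simp only [Matrix.mul_one, Matrix.mul_sub, Matrix.sub_mul, Matrix.mul_assoc]

lemma coordProj_mul_residualCov :
    coordProj (c \ s) * residualCov S c s = residualCov S c s := by
  rw [residualCov, ← Matrix.mul_assoc, ← Matrix.mul_assoc, coordProj_mul_self]

lemma residualCov_isSymm (hS : S.IsSymm) (c s : Finset V) : (residualCov S c s).IsSymm := by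
  simp only [IsSymm, residualCov, transpose_mul, transpose_sub, coordProj_transpose,
    localInv_transpose hS, hS.eq, Matrix.mul_assoc]

lemma coordProj_mul_localInv_mul_residualCov (hS : S.IsSymm) (hsc : s ⊆ c)
    (hc : (block S c).PosDef) :
    coordProj (c \ s) * localInv S c * residualCov S c s = coordProj (c \ s) :=
  calc coordProj (c \ s) * localInv S c * residualCov S c s
      = coordProj (c \ s) * (localInv S c * coordProj (c \ s) * (1 - regression S c s)) *
          S * coordProj (c \ s) := by
        rw [residualCov_eq]
        simp only [Matrix.mul_assoc]
    _ = coordProj (c \ s) * (localInv S c * S * coordProj c) * coordProj (c \ s) := by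
        rw [← localInv_sub_localInv_eq_mul hS hsc hc, Matrix.mul_sub,
          coordProj_mul_localInv_eq_zero S Finset.sdiff_disjoint, sub_zero]
        simp only [Matrix.mul_assoc, coordProj_mul_of_superset Finset.sdiff_subset]
    _ = coordProj (c \ s) := by
        rw [localInv_mul_mul_coordProj hc, coordProj_mul_of_subset Finset.sdiff_subset,
          coordProj_mul_self]

lemma inv_mul_coordProj_eq_self (hM : IsUnit M.det)
    (hMR : M * coordProj c = coordProj c) : M⁻¹ * coordProj c = coordProj c := by
  rw [← hMR, nonsing_inv_mul_cancel_left _ _ hM, hMR]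

lemma coordProj_mul_eq_self (hM : M.IsSymm) (hMR : M * coordProj c = coordProj c) :
    coordProj c * M = coordProj c := by
  simpa only [transpose_mul, hM.eq, coordProj_transpose] using congrArg transpose hMR

lemma sub_coordProj_eq_compl_conj (hM : M.IsSymm) (hMR : M * coordProj c = coordProj c) :
    M - coordProj c = coordProj cᶜ * M * coordProj cᶜ := by
  rw [← one_sub_coordProj, Matrix.sub_mul, coordProj_mul_eq_self hM hMR, Matrix.one_mul,
    Matrix.mul_sub, Matrix.mul_one, Matrix.sub_mul, hMR, coordProj_mul_self, sub_self, sub_zero]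

lemma attach_mul_inv (hS : S.IsSymm) (hsc : s ⊆ c) (hc : (block S c).PosDef) (hM : M.PosDef)
    (hMR : M * coordProj (c \ s) = coordProj (c \ s)) :
    (M - coordProj (c \ s) + coordProj (c \ s) * localInv S c * coordProj (c \ s)) *
      (M⁻¹ - coordProj (c \ s) + residualCov S c s) = 1 := by
  have hRN : coordProj (c \ s) * M⁻¹ = coordProj (c \ s) :=
    coordProj_mul_eq_self (isSymm_of_posDef hM.inv)
      (inv_mul_coordProj_eq_self hM.det_pos.ne'.isUnit hMR)
  have hcov : M * residualCov S c s = residualCov S c s := by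
    rw [← coordProj_mul_residualCov, ← Matrix.mul_assoc, hMR]
  simp only [Matrix.add_mul, Matrix.sub_mul, Matrix.mul_add, Matrix.mul_sub,
    mul_nonsing_inv M hM.det_pos.ne'.isUnit, hMR, hRN, hcov, coordProj_mul_self,
    coordProj_mul_residualCov, Matrix.mul_assoc _ (coordProj (c \ s)),
    coordProj_mul_localInv_mul_residualCov hS hsc hc]
  abel

lemma one_sub_regression_mul_one_add : (1 - regression S c s) * (1 + regression S c s) = 1 := by
  rw [Matrix.mul_add, Matrix.mul_one, Matrix.sub_mul, regression_mul_self, Matrix.one_mul, sub_zero,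
    sub_add_cancel]

lemma glue_mul_inv (hS : S.IsSymm) (hsc : s ⊆ c) (hc : (block S c).PosDef) (hM : M.PosDef)
    (hMR : M * coordProj (c \ s) = coordProj (c \ s)) :
    glue M S c s * ((1 + regression S c s) * (M⁻¹ - coordProj (c \ s) + residualCov S c s) *
      (1 + regression S c s)ᵀ) = 1 := by
  set B := regression S c s
  calc _ = (1 - B)ᵀ * ((M - coordProj (c \ s) +
            coordProj (c \ s) * localInv S c * coordProj (c \ s)) *
          (((1 - B) * (1 + B)) * (M⁻¹ - coordProj (c \ s) + residualCov S c s))) *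
          (1 + B)ᵀ := by
        rw [glue_eq_conj hS hsc hc (isSymm_of_posDef hM) hMR]
        simp only [Matrix.mul_assoc, B]
    _ = ((1 + B) * (1 - B))ᵀ := by
        rw [one_sub_regression_mul_one_add, Matrix.one_mul, attach_mul_inv hS hsc hc hM hMR,
          Matrix.mul_one, transpose_mul]
    _ = 1 := by
        rw [mul_eq_one_comm.1 one_sub_regression_mul_one_add, transpose_one]

lemma posSemidef_coordProj_conj (hM : M.PosSemidef) (c : Finset V) :
    (coordProj c * M * coordProj c).PosSemidef := by
  simpa only [conjTranspose_eq_transpose_of_trivial, coordProj_transpose] using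
    hM.conjTranspose_mul_mul_same (coordProj c)

lemma glue_posDef (hS : S.IsSymm) (hsc : s ⊆ c) (hc : (block S c).PosDef) (hM : M.PosDef)
    (hMR : M * coordProj (c \ s) = coordProj (c \ s)) : (glue M S c s).PosDef := by
  have hsemidef : (glue M S c s).PosSemidef := by
    rw [glue_eq_conj hS hsc hc (isSymm_of_posDef hM) hMR,
      sub_coordProj_eq_compl_conj (isSymm_of_posDef hM) hMR]
    exact (((posSemidef_coordProj_conj hM.posSemidef _).add
      (posSemidef_coordProj_conj (localInv_posSemidef hc) _)).conjTranspose_mul_mul_same _)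
  exact hsemidef.posDef_iff_isUnit.2 (IsUnit.of_mul_eq_one _ (glue_mul_inv hS hsc hc hM hMR))

lemma glue_inv_eq (hS : S.IsSymm) (hsc : s ⊆ c) (hc : (block S c).PosDef) (hM : M.PosDef)
    (hMR : M * coordProj (c \ s) = coordProj (c \ s)) :
    (glue M S c s)⁻¹ = (1 + regression S c s) *
      (coordProj (c \ s)ᶜ * M⁻¹ * coordProj (c \ s)ᶜ + residualCov S c s) *
      (1 + regression S c s)ᵀ := by
  rw [inv_eq_right_inv (glue_mul_inv hS hsc hc hM hMR), sub_coordProj_eq_compl_conj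
    (isSymm_of_posDef hM.inv) (inv_mul_coordProj_eq_self hM.det_pos.ne'.isUnit hMR)]

lemma compl_mul_one_add_regression :
    coordProj (c \ s)ᶜ * (1 + regression S c s) = coordProj (c \ s)ᶜ := by
  rw [Matrix.mul_add, Matrix.mul_one, ← coordProj_sdiff_mul_regression, ← Matrix.mul_assoc,
    coordProj_mul_eq_zero disjoint_compl_left, Matrix.zero_mul, add_zero]

lemma compl_mul_residualCov : coordProj (c \ s)ᶜ * residualCov S c s = 0 := by
  rw [← coordProj_mul_residualCov, ← Matrix.mul_assoc, coordProj_mul_eq_zero disjoint_compl_left,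
    Matrix.zero_mul]

lemma glue_inv_apply_of_notMem (hS : S.IsSymm) (hsc : s ⊆ c) (hc : (block S c).PosDef)
    (hM : M.PosDef) (hMR : M * coordProj (c \ s) = coordProj (c \ s)) {i j : V}
    (hi : i ∉ c \ s) (hj : j ∉ c \ s) : (glue M S c s)⁻¹ i j = M⁻¹ i j := by
  refine (coordProj_mul_mul_coordProj_eq_iff (c \ s)ᶜ _ _).1 ?_ i (Finset.mem_compl.2 hi) j
    (Finset.mem_compl.2 hj)
  rw [glue_inv_eq hS hsc hc hM hMR]
  have hPT : (coordProj (c \ s)ᶜ)ᵀ = coordProj (c \ s)ᶜ := coordProj_transpose _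
  have hPP : coordProj (c \ s)ᶜ * coordProj (c \ s)ᶜ = coordProj (c \ s)ᶜ := coordProj_mul_self _
  have hPU := compl_mul_one_add_regression (S := S) (c := c) (s := s)
  have hP_res := compl_mul_residualCov (S := S) (c := c) (s := s)
  set P := coordProj (c \ s)ᶜ
  calc P * ((1 + regression S c s) * (P * M⁻¹ * P + residualCov S c s) *
          (1 + regression S c s)ᵀ) * P
      = (P * (1 + regression S c s)) * (P * M⁻¹ * P + residualCov S c s) *
          (P * (1 + regression S c s))ᵀ := by
        rw [transpose_mul, hPT]
        simp only [Matrix.mul_assoc]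
    _ = (P * P) * M⁻¹ * (P * P) := by
        rw [hPU, hPT, Matrix.mul_add, hP_res, add_zero]
        simp only [Matrix.mul_assoc]
    _ = P * M⁻¹ * P := by rw [hPP]

lemma coordProj_mul_one_add_regression_mul_compl (hsc : s ⊆ c) :
    coordProj c * (1 + regression S c s) * coordProj (c \ s)ᶜ =
      (1 + regression S c s) * coordProj s := by
  have hregr : coordProj c * regression S c s = regression S c s := by
    rw [← coordProj_sdiff_mul_regression, ← Matrix.mul_assoc,
      coordProj_mul_of_superset Finset.sdiff_subset]
  rw [← one_sub_coordProj, Matrix.mul_add, Matrix.mul_one, hregr, Matrix.mul_sub, Matrix.mul_one,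
    Matrix.add_mul (coordProj c), regression_mul_coordProj_sdiff, add_zero,
    coordProj_mul_of_superset Finset.sdiff_subset, ← coordProj_add_sdiff hsc, Matrix.add_mul,
    Matrix.one_mul, regression_mul_coordProj]
  abel

lemma coordProj_mul_one_add_regression_mul_residualCov :
    coordProj c * (1 + regression S c s) * residualCov S c s = residualCov S c s := by
  rw [← coordProj_mul_residualCov, Matrix.mul_add, Matrix.mul_one, Matrix.add_mul,
    ← Matrix.mul_assoc, coordProj_mul_of_superset Finset.sdiff_subset, ← Matrix.mul_assoc,
    Matrix.mul_assoc (coordProj c), regression_mul_coordProj_sdiff, Matrix.mul_zero,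
    Matrix.zero_mul, add_zero]

lemma coordProj_mul_glue_inv_mul_coordProj (hS : S.IsSymm) (hsc : s ⊆ c)
    (hc : (block S c).PosDef) (hM : M.PosDef)
    (hMR : M * coordProj (c \ s) = coordProj (c \ s)) :
    coordProj c * (glue M S c s)⁻¹ * coordProj c = (1 + regression S c s) *
      (coordProj s * M⁻¹ * coordProj s) * (1 + regression S c s)ᵀ + residualCov S c s := by
  have hP := coordProj_mul_one_add_regression_mul_compl (S := S) hsc
  have hleft := coordProj_mul_one_add_regression_mul_residualCov (S := S) (c := c) (s := s)
  have hright : residualCov S c s * (coordProj c * (1 + regression S c s))ᵀ =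
      residualCov S c s := by
    have hsymm := residualCov_isSymm hS c s
    nth_rw 1 [← hsymm.eq]
    rw [← transpose_mul, hleft, hsymm.eq]
  have hglue := glue_inv_eq hS hsc hc hM hMR
  have hPT : (coordProj (c \ s)ᶜ)ᵀ = coordProj (c \ s)ᶜ := coordProj_transpose _
  set U := 1 + regression S c s
  set P := coordProj (c \ s)ᶜ
  calc coordProj c * (glue M S c s)⁻¹ * coordProj c
      = (coordProj c * U * P) * M⁻¹ * (coordProj c * U * P)ᵀ +
          coordProj c * U * (residualCov S c s * (coordProj c * U)ᵀ) := by
        simp only [hglue, transpose_mul, coordProj_transpose, hPT, Matrix.mul_add,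
          Matrix.add_mul, Matrix.mul_assoc]
    _ = _ := by
        rw [hP, hright, hleft, transpose_mul, coordProj_transpose]
        simp only [Matrix.mul_assoc]

lemma regression_conj_add_residualCov (hS : S.IsSymm) (hsc : s ⊆ c) (hs : (block S s).PosDef) :
    (1 + regression S c s) * (coordProj s * S * coordProj s) * (1 + regression S c s)ᵀ +
      residualCov S c s = coordProj c * S * coordProj c := by
  have hleft : (1 + regression S c s) * (coordProj s * S * coordProj s) =
      coordProj c * S * coordProj s := by
    rw [Matrix.add_mul, Matrix.one_mul, ← Matrix.mul_assoc, ← Matrix.mul_assoc,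
      regression_mul_coordProj, regression, Matrix.mul_assoc _ (localInv S s),
      Matrix.mul_assoc _ (localInv S s * S), localInv_mul_mul_coordProj hs, ← Matrix.add_mul,
      ← Matrix.add_mul, coordProj_add_sdiff hsc]
  have hcov : coordProj c * S * localInv S s * S * coordProj (c \ s) + residualCov S c s =
      coordProj c * S * coordProj (c \ s) := by
    rw [← coordProj_add_sdiff hsc, residualCov]
    simp only [Matrix.add_mul, Matrix.mul_sub, Matrix.sub_mul]
    rw [coordProj_mul_mul_localInv hS hs]
    simp only [Matrix.mul_assoc]
    abel
  rw [hleft, transpose_add, transpose_one, regression_transpose hS, Matrix.mul_add, Matrix.mul_one,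
    Matrix.mul_assoc _ (coordProj s), Matrix.mul_assoc (localInv S s),
    ← Matrix.mul_assoc _ (localInv S s), coordProj_mul_localInv, add_assoc]
  simp only [← Matrix.mul_assoc]
  rw [hcov, ← Matrix.mul_add, coordProj_add_sdiff hsc]

lemma glue_inv_apply_of_mem (hS : S.IsSymm) (hsc : s ⊆ c) (hc : (block S c).PosDef)
    (hM : M.PosDef) (hMR : M * coordProj (c \ s) = coordProj (c \ s))
    (hMs : ∀ i ∈ s, ∀ j ∈ s, M⁻¹ i j = S i j) {i j : V} (hi : i ∈ c) (hj : j ∈ c) :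
    (glue M S c s)⁻¹ i j = S i j := by
  refine (coordProj_mul_mul_coordProj_eq_iff c _ _).1 ?_ i hi j hj
  rw [coordProj_mul_glue_inv_mul_coordProj hS hsc hc hM hMR,
    (coordProj_mul_mul_coordProj_eq_iff s _ _).2 hMs,
    regression_conj_add_residualCov hS hsc (block_posDef_of_subset hsc hc)]

end Gluing

section Forest

section Graph

variable {ι : Type*} {T : SimpleGraph ι}

lemma exists_subsingleton_neighborSet_of_isAcyclic [Finite ι] [Nonempty ι] (hT : T.IsAcyclic) :
    ∃ l, (T.neighborSet l).Subsingleton := by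
  -- An endpoint of a longest path has no neighbour outside the path.
  obtain ⟨u, v, p, hp, hmax⟩ := SimpleGraph.Walk.exists_isPath_forall_isPath_length_le_length T
  have eq_snd : ∀ w, T.Adj u w → w = p.snd := by
    intro w hadj
    refine hT.eq_snd_of_adj_start hp hadj ?_
    by_contra hw
    have := hmax _ _ _ (hp.cons hw (h := hadj.symm))
    simp at this
  exact ⟨u, fun a ha b hb => (eq_snd a ha).trans (eq_snd b hb).symm⟩

lemma exists_mem_subsingleton_neighborSet_inter [Finite ι] (hT : T.IsAcyclic) {X : Set ι}
    (hX : X.Nonempty) : ∃ l ∈ X, (T.neighborSet l ∩ X).Subsingleton := by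
  have : Nonempty X := hX.to_subtype
  obtain ⟨l, hl⟩ := exists_subsingleton_neighborSet_of_isAcyclic (hT.induce X)
  exact ⟨l, l.2, fun a ha b hb => congrArg Subtype.val (@hl ⟨a, ha.2⟩ ha.1 ⟨b, hb.2⟩ hb.1)⟩

lemma preconnected_induce_sdiff_singleton {X : Set ι} {l : ι} (hX : (T.induce X).Preconnected)
    (hl : (T.neighborSet l ∩ X).Subsingleton) : (T.induce (X \ {l})).Preconnected := by
  have h : ((T.induce X).induce {i : X | (i : ι) ≠ l}).Preconnected := by
    refine hX.induce_of_degree_eq_one fun i hi a ha b hb => ?_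
    obtain rfl : (i : ι) = l := not_not.1 hi
    exact Subtype.ext (hl ⟨ha, a.2⟩ ⟨hb, b.2⟩)
  refine h.map (H := T.induce (X \ {l}))
    ⟨fun i => (⟨i.1.1, i.1.2, i.2⟩ : (X \ {l} : Set ι)), fun {a b} h => h⟩ ?_
  rintro ⟨i, hi⟩
  exact ⟨⟨⟨i, hi.1⟩, hi.2⟩, rfl⟩

end Graph

namespace CliqueForest

section RunningIntersection

variable {V ι : Type*} {G : SimpleGraph V} (F : CliqueForest G ι)

/-- A subfamily of the cliques has the running intersection property if, for every vertex, its
members containing that vertex are connected in the forest (or there are none). -/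
def HasRunningIntersection (A : Finset ι) : Prop :=
  ∀ v, (F.T.induce {i | i ∈ A ∧ v ∈ F.C i}).Preconnected

variable {F}

lemma hasRunningIntersection_univ [Fintype ι] : F.HasRunningIntersection Finset.univ := by
  intro v
  have hset : {i | i ∈ (Finset.univ : Finset ι) ∧ v ∈ F.C i} = {i | v ∈ F.C i} := by simp
  rw [hset]
  exact (F.connected v).preconnected

lemma exists_mem (v : V) : ∃ k, v ∈ F.C k := by
  obtain ⟨⟨k, hk⟩⟩ := (F.connected v).nonempty
  exact ⟨k, hk⟩

lemma exists_mem_and_mem_iff {i j : V} : (∃ k, i ∈ F.C k ∧ j ∈ F.C k) ↔ i = j ∨ G.Adj i j := by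
  rw [F.adj_iff]
  constructor
  · exact fun h => or_iff_not_imp_left.2 fun hij => ⟨hij, h⟩
  · rintro (rfl | h)
    · exact (exists_mem i).imp fun k hk => ⟨hk, hk⟩
    · exact h.2

variable [DecidableEq ι] {A : Finset ι} {l a : ι}

lemma HasRunningIntersection.of_insert (h : F.HasRunningIntersection (insert l A)) (hlA : l ∉ A)
    (hl : (F.T.neighborSet l ∩ A).Subsingleton) : F.HasRunningIntersection A := by
  intro v
  have hset : {i | i ∈ insert l A ∧ v ∈ F.C i} \ {l} = {i | i ∈ A ∧ v ∈ F.C i} := by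
    ext i
    by_cases hi : i = l
    · simp [hi, hlA]
    · simp [hi]
  rw [← hset]
  refine preconnected_induce_sdiff_singleton (h v) (hl.anti ?_)
  rintro i ⟨hli, hi, -⟩
  exact ⟨hli, (Finset.mem_insert.1 hi).resolve_left hli.ne'⟩

@[elab_as_elim]
lemma leaf_induction [Finite ι] {P : Finset ι → Prop} (empty : P ∅)
    (insert : ∀ l (A : Finset ι), l ∉ A → (F.T.neighborSet l ∩ A).Subsingleton →
      F.HasRunningIntersection (insert l A) → P A → P (insert l A))
    (hA : F.HasRunningIntersection A) : P A := by
  induction A using Finset.strongInduction with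
  | H A ih =>
  obtain rfl | hne := A.eq_empty_or_nonempty
  · exact empty
  obtain ⟨l, hlA, hl⟩ := exists_mem_subsingleton_neighborSet_inter F.acyclic hne
  have hsub : A.erase l ⊂ A := Finset.erase_ssubset hlA
  have hl' : (F.T.neighborSet l ∩ A.erase l).Subsingleton :=
    hl.anti (Set.inter_subset_inter_right _ hsub.subset)
  rw [← Finset.insert_erase hlA] at hA ⊢
  have hlA' := Finset.notMem_erase l A
  exact insert l _ hlA' hl' hA (ih _ hsub (hA.of_insert hlA' hl'))

lemma exists_adj_of_mem (h : F.HasRunningIntersection (insert l A)) (hlA : l ∉ A) {v : V}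
    (hvl : v ∈ F.C l) {k : ι} (hk : k ∈ A) (hvk : v ∈ F.C k) :
    ∃ a ∈ A, F.T.Adj l a ∧ v ∈ F.C a := by
  obtain ⟨p⟩ := h v ⟨l, Finset.mem_insert_self _ _, hvl⟩ ⟨k, Finset.mem_insert_of_mem hk, hvk⟩
  cases p with
  | nil => exact absurd hk hlA
  | @cons _ a _ hadj _ =>
    have hne : (a : ι) ≠ l := (SimpleGraph.Adj.ne (G := F.T) hadj).symm
    exact ⟨a, (Finset.mem_insert.1 a.2.1).resolve_left hne, hadj, a.2.2⟩

variable [DecidableEq V]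

lemma inter_biUnion_eq_empty (h : F.HasRunningIntersection (insert l A)) (hlA : l ∉ A)
    (hl : ∀ a ∈ A, ¬ F.T.Adj l a) : F.C l ∩ A.biUnion F.C = ∅ := by
  rw [Finset.eq_empty_iff_forall_notMem]
  intro v hv
  obtain ⟨hvl, hvA⟩ := Finset.mem_inter.1 hv
  obtain ⟨k, hk, hvk⟩ := Finset.mem_biUnion.1 hvA
  obtain ⟨a, ha, hla, -⟩ := exists_adj_of_mem h hlA hvl hk hvk
  exact hl a ha hla

lemma inter_biUnion_eq_inter (h : F.HasRunningIntersection (insert l A)) (hlA : l ∉ A)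
    (hl : (F.T.neighborSet l ∩ A).Subsingleton) (ha : a ∈ A) (hla : F.T.Adj l a) :
    F.C l ∩ A.biUnion F.C = F.C l ∩ F.C a := by
  refine subset_antisymm (fun v hv => ?_)
    (Finset.inter_subset_inter_left (Finset.subset_biUnion_of_mem F.C ha))
  obtain ⟨hvl, hvA⟩ := Finset.mem_inter.1 hv
  obtain ⟨k, hk, hvk⟩ := Finset.mem_biUnion.1 hvA
  obtain ⟨b, hb, hlb, hvb⟩ := exists_adj_of_mem h hlA hvl hk hvk
  rw [hl ⟨hla, ha⟩ ⟨hlb, hb⟩]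
  exact Finset.mem_inter.2 ⟨hvl, hvb⟩

lemma inter_biUnion_eq_empty_or_subset (h : F.HasRunningIntersection (insert l A)) (hlA : l ∉ A)
    (hl : (F.T.neighborSet l ∩ A).Subsingleton) :
    F.C l ∩ A.biUnion F.C = ∅ ∨ ∃ k ∈ A, F.C l ∩ A.biUnion F.C ⊆ F.C k := by
  by_cases hex : ∃ a ∈ A, F.T.Adj l a
  · obtain ⟨a, ha, hla⟩ := hex
    rw [inter_biUnion_eq_inter h hlA hl ha hla]
    exact Or.inr ⟨a, ha, Finset.inter_subset_right⟩
  · exact Or.inl (inter_biUnion_eq_empty h hlA fun a ha hla => hex ⟨a, ha, hla⟩)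

end RunningIntersection

section EdgesIn

variable {V ι : Type*} [Fintype ι] {G : SimpleGraph V} (F : CliqueForest G ι)

open Classical in
/-- The edges of the clique forest between cliques in `A`. -/
def edgesIn (A : Finset ι) : Finset (Sym2 ι) :=
  F.T.edgeFinset.filter fun e => ∀ i ∈ e, i ∈ A

variable {F} {A : Finset ι} {i j l a : ι}

lemma mem_edgesIn : s(i, j) ∈ F.edgesIn A ↔ F.T.Adj i j ∧ i ∈ A ∧ j ∈ A := by
  simp [edgesIn]

lemma edgesIn_empty : F.edgesIn ∅ = ∅ := by
  ext e
  induction e using Sym2.ind with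
  | _ i j => simp [mem_edgesIn]

variable [DecidableEq ι]

lemma edgesIn_insert_of_forall_not_adj (hl : ∀ a ∈ A, ¬ F.T.Adj l a) :
    F.edgesIn (insert l A) = F.edgesIn A := by
  ext e
  induction e using Sym2.ind with
  | _ i j =>
  simp only [mem_edgesIn, Finset.mem_insert]
  constructor
  · rintro ⟨hij, rfl | hi, rfl | hj⟩
    · exact absurd hij F.T.irrefl
    · exact absurd hij (hl j hj)
    · exact absurd hij.symm (hl i hi)
    · exact ⟨hij, hi, hj⟩
  · exact fun ⟨hij, hi, hj⟩ => ⟨hij, Or.inr hi, Or.inr hj⟩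

lemma edgesIn_insert_of_adj (hl : (F.T.neighborSet l ∩ A).Subsingleton) (ha : a ∈ A)
    (hla : F.T.Adj l a) : F.edgesIn (insert l A) = insert s(l, a) (F.edgesIn A) := by
  ext e
  induction e using Sym2.ind with
  | _ i j =>
  rw [Finset.mem_insert]
  simp only [mem_edgesIn, Finset.mem_insert]
  constructor
  · rintro ⟨hij, rfl | hi, rfl | hj⟩
    · exact absurd hij F.T.irrefl
    · exact Or.inl (by rw [hl ⟨hla, ha⟩ ⟨hij, hj⟩])
    · exact Or.inl (by rw [hl ⟨hla, ha⟩ ⟨hij.symm, hi⟩, Sym2.eq_swap])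
    · exact Or.inr ⟨hij, hi, hj⟩
  · rintro (h | ⟨hij, hi, hj⟩)
    · rcases Sym2.eq_iff.1 h with ⟨rfl, rfl⟩ | ⟨rfl, rfl⟩
      · exact ⟨hla, Or.inl rfl, Or.inr ha⟩
      · exact ⟨hla.symm, Or.inr ha, Or.inl rfl⟩
    · exact ⟨hij, Or.inr hi, Or.inr hj⟩

end EdgesIn

section PartialSum

variable {V ι : Type*} [DecidableEq V] [Fintype ι] {G : SimpleGraph V} {F : CliqueForest G ι}

lemma sep_subset_of_mem_edgesIn {A : Finset ι} {e : Sym2 ι} (he : e ∈ F.edgesIn A) :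
    ∃ k ∈ A, F.sep e ⊆ F.C k := by
  induction e using Sym2.ind with
  | _ i j => exact ⟨i, (mem_edgesIn.1 he).2.1, Finset.inter_subset_left⟩

lemma sum_edgesIn_insert [DecidableEq ι] {S : Matrix V V ℝ} {A : Finset ι}
    {l : ι} (h : F.HasRunningIntersection (insert l A)) (hlA : l ∉ A)
    (hl : (F.T.neighborSet l ∩ A).Subsingleton) :
    ∑ e ∈ F.edgesIn (insert l A), localInv S (F.sep e) =
      ∑ e ∈ F.edgesIn A, localInv S (F.sep e) + localInv S (F.C l ∩ A.biUnion F.C) := by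
  by_cases hex : ∃ a ∈ A, F.T.Adj l a
  · obtain ⟨a, ha, hla⟩ := hex
    have hnot : s(l, a) ∉ F.edgesIn A := fun hmem => hlA (mem_edgesIn.1 hmem).2.1
    rw [edgesIn_insert_of_adj hl ha hla, Finset.sum_insert hnot,
      inter_biUnion_eq_inter h hlA hl ha hla, add_comm]
    rfl
  · have hnot : ∀ a ∈ A, ¬ F.T.Adj l a := fun a ha hla => hex ⟨a, ha, hla⟩
    rw [edgesIn_insert_of_forall_not_adj hnot, inter_biUnion_eq_empty h hlA hnot, localInv_empty,
      add_zero]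

variable [Fintype V] (F)

/-- The clique-minus-separator sum over the subfamily `A`, completed by the identity on the
vertices outside its cliques. -/
def partialSum (S : Matrix V V ℝ) (A : Finset ι) : Matrix V V ℝ :=
  coordProj (A.biUnion F.C)ᶜ + ∑ k ∈ A, localInv S (F.C k) - ∑ e ∈ F.edgesIn A, localInv S (F.sep e)

variable {F} {S : Matrix V V ℝ} {A : Finset ι} {l : ι}

lemma partialSum_empty : F.partialSum S ∅ = 1 := by
  simp [partialSum, edgesIn_empty, coordProj_univ]

lemma partialSum_mul_coordProj {R : Finset V} (hR : Disjoint R (A.biUnion F.C)) :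
    F.partialSum S A * coordProj R = coordProj R := by
  have clique_mul : ∀ k ∈ A, ∀ c ⊆ F.C k, localInv S c * coordProj R = 0 := fun k hk c hc =>
    localInv_mul_coordProj_eq_zero S
      ((hR.mono_right (hc.trans (Finset.subset_biUnion_of_mem F.C hk))).symm)
  rw [partialSum, Matrix.sub_mul, Matrix.add_mul, Matrix.sum_mul, Matrix.sum_mul,
    Finset.sum_eq_zero fun k hk => clique_mul k hk _ subset_rfl,
    Finset.sum_eq_zero fun e he => ?_, coordProj_mul_of_superset, add_zero, sub_zero]
  · exact Finset.subset_compl_iff_disjoint_right.2 hR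
  · obtain ⟨k, hk, hek⟩ := sep_subset_of_mem_edgesIn he
    exact clique_mul k hk _ hek

lemma partialSum_insert [DecidableEq ι] (h : F.HasRunningIntersection (insert l A))
    (hlA : l ∉ A) (hl : (F.T.neighborSet l ∩ A).Subsingleton) :
    F.partialSum S (insert l A) =
      glue (F.partialSum S A) S (F.C l) (F.C l ∩ A.biUnion F.C) := by
  have hcompl : coordProj (A.biUnion F.C)ᶜ =
      coordProj ((insert l A).biUnion F.C)ᶜ +
        coordProj (F.C l \ (F.C l ∩ A.biUnion F.C)) := by
    rw [Finset.biUnion_insert, Finset.sdiff_inter_self_left, coordProj_add_of_disjoint]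
    · congr 1
      ext v
      simp only [Finset.mem_compl, Finset.mem_union, Finset.mem_sdiff]
      tauto
    · exact disjoint_compl_left.mono_right (Finset.sdiff_subset.trans Finset.subset_union_left)
  rw [glue, partialSum, partialSum, sum_edgesIn_insert h hlA hl, Finset.sum_insert hlA, hcompl]
  abel

end PartialSum

section CliqueMinusSep

variable {V ι : Type*} [DecidableEq V] {G : SimpleGraph V} {F : CliqueForest G ι}
  {S : Matrix V V ℝ}

lemma sep_posDef (hpd : ∀ k, (block S (F.C k)).PosDef) (e : Sym2 ι) :
    (block S (F.sep e)).PosDef := by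
  induction e using Sym2.ind with
  | _ a b => exact block_posDef_of_subset Finset.inter_subset_left (hpd a)

variable [Fintype ι]

lemma cliqueMinusSep_apply_eq_zero {i j : V} (h : ¬ ∃ k, i ∈ F.C k ∧ j ∈ F.C k) :
    cliqueMinusSep F S i j = 0 := by
  rw [cliqueMinusSep, Finset.sum_eq_zero, Finset.sum_eq_zero, sub_zero]
  · intro e _
    induction e using Sym2.ind with
    | _ a b =>
      refine localInv_apply_eq_zero S fun hmem => h ⟨a, ?_⟩
      exact hmem.imp Finset.mem_of_mem_inter_left Finset.mem_of_mem_inter_left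
  · exact fun k _ => localInv_apply_eq_zero S fun hmem => h ⟨k, hmem⟩

lemma cliqueMinusSep_eq_partialSum [Fintype V] :
    cliqueMinusSep F S = F.partialSum S Finset.univ := by
  have hU : (Finset.univ.biUnion F.C)ᶜ = ∅ := by
    ext v
    simpa using exists_mem v
  ext i j
  rw [partialSum, hU, coordProj_empty]
  simp [cliqueMinusSep, edgesIn, Matrix.sum_apply]

theorem partialSum_posDef_and_inv_apply_eq [Fintype V] (hS : S.IsSymm)
    (hpd : ∀ k, (block S (F.C k)).PosDef) {A : Finset ι} (hA : F.HasRunningIntersection A) :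
    (F.partialSum S A).PosDef ∧
      ∀ k ∈ A, ∀ i ∈ F.C k, ∀ j ∈ F.C k, (F.partialSum S A)⁻¹ i j = S i j := by
  classical
  refine leaf_induction ?_ (fun l A hlA hl h ih => ?_) hA
  · rw [partialSum_empty]
    exact ⟨PosDef.one, by simp⟩
  obtain ⟨hM, hinv⟩ := ih
  rw [partialSum_insert h hlA hl]
  set s := F.C l ∩ A.biUnion F.C with hs
  have hsl : s ⊆ F.C l := Finset.inter_subset_left
  have hdisj : Disjoint (F.C l \ s) (A.biUnion F.C) := by
    rw [hs, Finset.sdiff_inter_self_left]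
    exact Finset.sdiff_disjoint
  have hMR := partialSum_mul_coordProj (S := S) hdisj
  have hMs : ∀ i ∈ s, ∀ j ∈ s, (F.partialSum S A)⁻¹ i j = S i j := by
    rcases inter_biUnion_eq_empty_or_subset h hlA hl with hs' | ⟨k, hk, hsk⟩
    · simp [hs, hs']
    · exact fun i hi j hj => hinv k hk i (hsk hi) j (hsk hj)
  refine ⟨glue_posDef hS hsl (hpd l) hM hMR, fun k hk i hi j hj => ?_⟩
  rcases Finset.mem_insert.1 hk with rfl | hk
  · exact glue_inv_apply_of_mem hS hsl (hpd k) hM hMR hMs hi hj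
  · have hnot : ∀ v ∈ F.C k, v ∉ F.C l \ s := fun v hv hv' =>
      Finset.disjoint_left.1 hdisj hv' (Finset.mem_biUnion.2 ⟨k, hk, hv⟩)
    rw [glue_inv_apply_of_notMem hS hsl (hpd l) hM hMR (hnot i hi) (hnot j hj)]
    exact hinv k hk i hi j hj

lemma cliqueMinusSep_posDef [Finite V] (hS : S.IsSymm) (hpd : ∀ k, (block S (F.C k)).PosDef) :
    (cliqueMinusSep F S).PosDef := by
  have := Fintype.ofFinite V
  rw [cliqueMinusSep_eq_partialSum]
  exact (partialSum_posDef_and_inv_apply_eq hS hpd hasRunningIntersection_univ).1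

lemma cliqueMinusSep_inv_apply [Fintype V] (hS : S.IsSymm)
    (hpd : ∀ k, (block S (F.C k)).PosDef) {i j : V} (h : ∃ k, i ∈ F.C k ∧ j ∈ F.C k) :
    (cliqueMinusSep F S)⁻¹ i j = S i j := by
  obtain ⟨k, hi, hj⟩ := h
  rw [cliqueMinusSep_eq_partialSum]
  exact (partialSum_posDef_and_inv_apply_eq hS hpd hasRunningIntersection_univ).2 k
    (Finset.mem_univ k) i hi j hj

end CliqueMinusSep

end CliqueForest

end Forest

section LogDet

variable {V : Type*} [Fintype V] {J K : Matrix V V ℝ}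

lemma posDef_of_forall_mem_sphere {A : Matrix V V ℝ} (hA : A.IsSymm)
    (h : ∀ y ∈ Metric.sphere (0 : V → ℝ) 1, 0 < y ⬝ᵥ (A *ᵥ y)) : A.PosDef := by
  refine PosDef.of_dotProduct_mulVec_pos (isHermitian_iff_isSymm.2 hA) fun y hy => ?_
  have hn : 0 < ‖y‖⁻¹ := inv_pos.2 (norm_pos_iff.2 hy)
  have hscaled := h (‖y‖⁻¹ • y) (by simp [norm_smul, hy])
  rw [mulVec_smul, dotProduct_smul, smul_dotProduct, smul_eq_mul, smul_eq_mul] at hscaled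
  rw [star_trivial]
  exact (mul_pos_iff_of_pos_left hn).1 ((mul_pos_iff_of_pos_left hn).1 hscaled)

lemma eventually_posDef_add_smul {V : Type*} [Finite V] {J H : Matrix V V ℝ} (hJ : J.PosDef)
    (hH : H.IsSymm) :
    ∀ᶠ t : ℝ in 𝓝 0, (J + t • H).PosDef := by
  have := Fintype.ofFinite V
  have hcont : Continuous fun z : ℝ × (V → ℝ) => z.2 ⬝ᵥ ((J + z.1 • H) *ᵥ z.2) := by
    fun_prop
  have hsphere : ∀ᶠ t : ℝ in 𝓝 0, ∀ y ∈ Metric.sphere (0 : V → ℝ) 1,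
      0 < y ⬝ᵥ ((J + t • H) *ᵥ y) := by
    refine (isCompact_sphere _ _).eventually_forall_of_forall_eventually fun y hy => ?_
    refine hcont.continuousAt.eventually (lt_mem_nhds ?_)
    have hy0 : y ≠ 0 := ne_zero_of_mem_unit_sphere ⟨y, hy⟩
    simpa using hJ.dotProduct_mulVec_pos hy0
  filter_upwards [hsphere] with t ht
  exact posDef_of_forall_mem_sphere ((isSymm_of_posDef hJ).add (hH.smul t)) ht

lemma exists_isUnit_eq_transpose_mul_self [DecidableEq V] (hJ : J.PosDef) :
    ∃ B : Matrix V V ℝ, IsUnit B ∧ J = Bᵀ * B := by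
  open scoped MatrixOrder in
  obtain ⟨B, hB⟩ := CStarAlgebra.nonneg_iff_eq_star_mul_self.mp hJ.posSemidef.nonneg
  rw [star_eq_conjTranspose, conjTranspose_eq_transpose_of_trivial] at hB
  have h := hJ.isUnit
  rw [isUnit_iff_isUnit_det, hB, det_mul] at h
  exact ⟨B, (isUnit_iff_isUnit_det B).2 (isUnit_of_mul_isUnit_right h), hB⟩

lemma eq_zero_of_trace_mul_conj_eq_zero {D : Matrix V V ℝ} (hJ : J.PosDef) (hK : K.PosDef)
    (h : (Dᵀ * (J * D * K)).trace = 0) : D = 0 := by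
  classical
  obtain ⟨B, hBu, rfl⟩ := exists_isUnit_eq_transpose_mul_self hJ
  obtain ⟨C, hCu, rfl⟩ := exists_isUnit_eq_transpose_mul_self hK
  have hconj : ((B * D * Cᵀ)ᴴ * (B * D * Cᵀ)).trace = 0 := by
    rw [← h, conjTranspose_eq_transpose_of_trivial, transpose_mul, transpose_mul,
      transpose_transpose, Matrix.mul_assoc, trace_mul_comm]
    simp only [Matrix.mul_assoc]
  have hzero : B * D * Cᵀ = 0 := trace_conjTranspose_mul_self_eq_zero_iff.1 hconj
  have hCu' : IsUnit Cᵀ := (isUnit_transpose C).2 hCu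
  rwa [hCu'.mul_left_eq_zero, hBu.mul_right_eq_zero] at hzero

variable [DecidableEq V]

lemma isUnit_det_of_posDef (hJ : J.PosDef) : IsUnit J.det := hJ.det_pos.ne'.isUnit

lemma log_det_le_trace_sub_card (hJ : J.PosDef) :
    Real.log J.det ≤ J.trace - Fintype.card V := by
  rw [hJ.isHermitian.det_eq_prod_eigenvalues, hJ.isHermitian.trace_eq_sum_eigenvalues]
  simp only [RCLike.ofReal_real_eq_id, id]
  rw [Real.log_prod fun i _ => (hJ.eigenvalues_pos i).ne']
  calc ∑ i, Real.log (hJ.isHermitian.eigenvalues i)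
      ≤ ∑ i, (hJ.isHermitian.eigenvalues i - 1) :=
        Finset.sum_le_sum fun i _ => Real.log_le_sub_one_of_pos (hJ.eigenvalues_pos i)
    _ = _ := by simp [Finset.sum_sub_distrib]

lemma log_det_le_log_det_add_trace (hJ : J.PosDef) (hK : K.PosDef) :
    Real.log K.det ≤ Real.log J.det + (J⁻¹ * (K - J)).trace := by
  obtain ⟨B, hBu, hB⟩ := exists_isUnit_eq_transpose_mul_self hJ.inv
  have hpos : (B * K * Bᵀ).PosDef := by
    have := hK.mul_mul_conjTranspose_same (vecMul_injective_of_isUnit hBu)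
    rwa [conjTranspose_eq_transpose_of_trivial] at this
  have hdet : (B * K * Bᵀ).det = J.det⁻¹ * K.det := by
    rw [← Ring.inverse_eq_inv', ← det_nonsing_inv, hB, det_mul, det_mul, det_mul]
    ring
  have htrace : (B * K * Bᵀ).trace = (J⁻¹ * K).trace := by
    rw [hB, trace_mul_comm, ← Matrix.mul_assoc]
  have h := log_det_le_trace_sub_card hpos
  rw [hdet, htrace, Real.log_mul (inv_ne_zero hJ.det_pos.ne') hK.det_pos.ne', Real.log_inv] at h
  rw [Matrix.mul_sub, nonsing_inv_mul _ (isUnit_det_of_posDef hJ), trace_sub, trace_one]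
  linarith

lemma eq_of_trace_mul_inv_sub_inv_eq_zero (hJ : J.PosDef) (hK : K.PosDef)
    (h : ((J - K) * (J⁻¹ - K⁻¹)).trace = 0) : J = K := by
  have hsymm : (J - K)ᵀ = J - K := (isSymm_of_posDef hJ).sub (isSymm_of_posDef hK)
  have hinv : J⁻¹ - K⁻¹ = -(J⁻¹ * (J - K) * K⁻¹) := by
    rw [Matrix.mul_sub, Matrix.sub_mul, nonsing_inv_mul _ (isUnit_det_of_posDef hJ),
      Matrix.mul_assoc, mul_nonsing_inv _ (isUnit_det_of_posDef hK), Matrix.one_mul,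
      Matrix.mul_one, neg_sub]
  rw [hinv, Matrix.mul_neg, trace_neg, neg_eq_zero] at h
  exact sub_eq_zero.1 (eq_zero_of_trace_mul_conj_eq_zero hJ.inv hK.inv (hsymm.symm ▸ h))

lemma hasDerivAt_det_one_add_smul (M : Matrix V V ℝ) :
    HasDerivAt (fun t : ℝ => (1 + t • M).det) M.trace 0 := by
  simp only [fun t : ℝ => det_one_add_smul t M]
  set P := (det (1 + (Polynomial.X : Polynomial ℝ) • M.map Polynomial.C)).divX.divX
  have h := (((hasDerivAt_id (0 : ℝ)).const_mul M.trace).const_add 1).add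
    ((P.hasDerivAt 0).mul ((hasDerivAt_id (0 : ℝ)).pow 2))
  exact h.congr_deriv (by simp)

lemma hasDerivAt_log_det_add_smul (hJ : J.PosDef) (H : Matrix V V ℝ) :
    HasDerivAt (fun t : ℝ => Real.log (J + t • H).det) (J⁻¹ * H).trace 0 := by
  have hfactor (t : ℝ) : (J + t • H).det = J.det * (1 + t • (J⁻¹ * H)).det := by
    rw [← det_mul, Matrix.mul_add, Matrix.mul_one, Matrix.mul_smul,
      mul_nonsing_inv_cancel_left _ _ (isUnit_det_of_posDef hJ)]
  have hdet : HasDerivAt (fun t : ℝ => (J + t • H).det) (J.det * (J⁻¹ * H).trace) 0 := by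
    simp only [hfactor]
    exact (hasDerivAt_det_one_add_smul _).const_mul _
  have hne := hJ.det_pos.ne'
  refine (hdet.log (by simpa using hne)).congr_deriv ?_
  rw [zero_smul, add_zero, mul_div_cancel_left₀ _ hne]

end LogDet

section Precisions

section AgreeOn

variable {V R : Type*} {G : SimpleGraph V}

/-- Matrices whose off-diagonal entries vanish off the edges of `G`: the directions in which an
admissible inverse covariance may be varied. -/
def IsSparse [Zero R] (G : SimpleGraph V) (H : Matrix V V R) : Prop :=
  ∀ i j, i ≠ j → ¬ G.Adj i j → H i j = 0

/-- Agreement of two matrices on the diagonal and on the edges of `G`. -/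
def AgreeOn (G : SimpleGraph V) (A B : Matrix V V R) : Prop :=
  ∀ i j, i = j ∨ G.Adj i j → A i j = B i j

lemma AgreeOn.symm {A B : Matrix V V R} (h : AgreeOn G A B) : AgreeOn G B A :=
  fun i j hij => (h i j hij).symm

lemma AgreeOn.trans {A B C : Matrix V V R} (h : AgreeOn G A B) (h' : AgreeOn G B C) :
    AgreeOn G A C :=
  fun i j hij => (h i j hij).trans (h' i j hij)

lemma IsSparse.add [AddZeroClass R] {A B : Matrix V V R} (hA : IsSparse G A)
    (hB : IsSparse G B) : IsSparse G (A + B) := fun i j hij hadj => by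
  rw [Matrix.add_apply, hA i j hij hadj, hB i j hij hadj, add_zero]

lemma IsSparse.sub [AddGroup R] {A B : Matrix V V R} (hA : IsSparse G A) (hB : IsSparse G B) :
    IsSparse G (A - B) := fun i j hij hadj => by
  rw [Matrix.sub_apply, hA i j hij hadj, hB i j hij hadj, sub_zero]

lemma IsSparse.smul [MulZeroClass R] {A : Matrix V V R} (hA : IsSparse G A) (r : R) :
    IsSparse G (r • A) := fun i j hij hadj => by
  rw [Matrix.smul_apply, hA i j hij hadj, smul_zero]

lemma AgreeOn.trace_mul_eq [Fintype V] [NonUnitalNonAssocSemiring R] {A B D : Matrix V V R}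
    (h : AgreeOn G A B) (hD : IsSparse G D) : (A * D).trace = (B * D).trace := by
  simp only [trace, diag_apply, mul_apply]
  refine Finset.sum_congr rfl fun i _ => Finset.sum_congr rfl fun j _ => ?_
  by_cases hij : i = j ∨ G.Adj i j
  · rw [h i j hij]
  · obtain ⟨hne, hadj⟩ := not_or.1 hij
    rw [hD j i (Ne.symm hne) fun h => hadj h.symm, mul_zero, mul_zero]

lemma isSparse_single_add_single [DecidableEq V] [AddZeroClass R] {i j : V}
    (hij : i = j ∨ G.Adj i j) (r : R) :
    IsSparse G (Matrix.single i j r + Matrix.single j i r) := by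
  intro a b hab hadj
  have h (c d : V) (hcd : c = d ∨ G.Adj c d) : ¬ (c = a ∧ d = b) := by
    rintro ⟨rfl, rfl⟩
    exact hcd.elim hab hadj
  rw [Matrix.add_apply, single_apply_of_ne _ _ _ _ _ (h i j hij),
    single_apply_of_ne _ _ _ _ _ (h j i (hij.imp Eq.symm SimpleGraph.Adj.symm)), add_zero]

lemma trace_mul_single_add_single [Fintype V] [DecidableEq V] {C : Matrix V V ℝ}
    (hC : C.IsSymm) (i j : V) :
    (C * (Matrix.single i j 1 + Matrix.single j i 1)).trace = 2 * C i j := by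
  rw [Matrix.mul_add, trace_add, trace_mul_single, trace_mul_single, hC.apply i j,
    MulOpposite.op_one, one_smul, two_mul]

lemma agreeOn_of_trace_mul_eq [Fintype V] {A B : Matrix V V ℝ} (hA : A.IsSymm) (hB : B.IsSymm)
    (h : ∀ H : Matrix V V ℝ, H.IsSymm → IsSparse G H → (A * H).trace = (B * H).trace) :
    AgreeOn G A B := by
  classical
  intro i j hij
  have hsymm : (Matrix.single i j (1 : ℝ) + Matrix.single j i 1).IsSymm := by
    rw [IsSymm, transpose_add, transpose_single, transpose_single, add_comm]
  have htrace := h _ hsymm (isSparse_single_add_single hij 1)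
  rw [trace_mul_single_add_single hA, trace_mul_single_add_single hB] at htrace
  exact mul_left_cancel₀ two_ne_zero htrace

end AgreeOn

variable {V : Type*} {G : SimpleGraph V}

/-- The admissible inverse covariances: the second components of `params G`. -/
def precisions (G : SimpleGraph V) : Set (Matrix V V ℝ) := {J | J.PosDef ∧ IsSparse G J}

variable [Fintype V] [DecidableEq V] {S J K : Matrix V V ℝ}

lemma eq_of_agreeOn_inv (hJ : J ∈ precisions G) (hK : K ∈ precisions G)
    (h : AgreeOn G J⁻¹ K⁻¹) : J = K := by
  refine eq_of_trace_mul_inv_sub_inv_eq_zero hJ.1 hK.1 ?_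
  rw [trace_mul_comm, Matrix.sub_mul, trace_sub, sub_eq_zero]
  exact h.trace_mul_eq (hJ.2.sub hK.2)

/-- The Gaussian log-likelihood of the inverse covariance `J` for a sample covariance `S`, up to
constants and a factor. -/
def gaussObj (S J : Matrix V V ℝ) : ℝ := Real.log J.det - (S * J).trace

lemma hasDerivAt_gaussObj (hJ : J.PosDef) (S H : Matrix V V ℝ) :
    HasDerivAt (fun t : ℝ => gaussObj S (J + t • H)) ((J⁻¹ * H).trace - (S * H).trace) 0 := by
  unfold gaussObj
  refine (hasDerivAt_log_det_add_smul hJ H).sub ?_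
  simp only [Matrix.mul_add, trace_add, Matrix.mul_smul, trace_smul, smul_eq_mul]
  simpa using ((hasDerivAt_id (0 : ℝ)).mul_const (S * H).trace).const_add (S * J).trace

lemma gaussObj_le_of_agreeOn (hJ : J ∈ precisions G) (hK : K ∈ precisions G)
    (h : AgreeOn G J⁻¹ S) : gaussObj S K ≤ gaussObj S J := by
  have htangent := log_det_le_log_det_add_trace hJ.1 hK.1
  rw [h.trace_mul_eq (hK.2.sub hJ.2), Matrix.mul_sub, trace_sub] at htangent
  unfold gaussObj
  linarith

lemma agreeOn_of_forall_gaussObj_le (hS : S.IsSymm) (hJ : J ∈ precisions G)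
    (h : ∀ K ∈ precisions G, gaussObj S K ≤ gaussObj S J) : AgreeOn G J⁻¹ S := by
  refine agreeOn_of_trace_mul_eq (isSymm_of_posDef hJ.1.inv) hS fun H hH hH0 => ?_
  have hmax : IsLocalMax (fun t : ℝ => gaussObj S (J + t • H)) 0 := by
    filter_upwards [eventually_posDef_add_smul hJ.1 hH] with t ht
    rw [zero_smul, add_zero]
    exact h _ ⟨ht, hJ.2.add (hH0.smul t)⟩
  exact sub_eq_zero.1 (hmax.hasDerivAt_eq_zero (hasDerivAt_gaussObj hJ.1 S H))

end Precisions

section Completion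

variable {V ι : Type*} {G : SimpleGraph V} {S : Matrix V V ℝ}

namespace CliqueForest

lemma agreeOn_iff (F : CliqueForest G ι) {A B : Matrix V V ℝ} :
    AgreeOn G A B ↔ ∀ i j, (∃ k, i ∈ F.C k ∧ j ∈ F.C k) → A i j = B i j := by
  simp only [AgreeOn, F.exists_mem_and_mem_iff]

lemma block_congr_of_agreeOn (F : CliqueForest G ι) {A B : Matrix V V ℝ} (h : AgreeOn G A B)
    (k : ι) : block A (F.C k) = block B (F.C k) := by
  ext i j
  exact F.agreeOn_iff.1 h i j ⟨k, i.2, j.2⟩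

variable [DecidableEq V] {F : CliqueForest G ι}

lemma block_posDef_of_agreeOn_inv [Fintype V] {J : Matrix V V ℝ} (hJ : J.PosDef)
    (h : AgreeOn G J⁻¹ S) (k : ι) : (block S (F.C k)).PosDef := by
  rw [← F.block_congr_of_agreeOn h]
  exact hJ.inv.submatrix Subtype.val_injective

variable [Fintype ι]

lemma cliqueMinusSep_mem_precisions [Finite V] (hS : S.IsSymm)
    (hpd : ∀ k, (block S (F.C k)).PosDef) : cliqueMinusSep F S ∈ precisions G := by
  refine ⟨cliqueMinusSep_posDef hS hpd, fun i j hij hadj => cliqueMinusSep_apply_eq_zero ?_⟩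
  rw [exists_mem_and_mem_iff]
  exact fun h => h.elim hij hadj

variable [Fintype V]

lemma agreeOn_inv_cliqueMinusSep (hS : S.IsSymm) (hpd : ∀ k, (block S (F.C k)).PosDef) :
    AgreeOn G (cliqueMinusSep F S)⁻¹ S :=
  F.agreeOn_iff.2 fun _ _ h => cliqueMinusSep_inv_apply hS hpd h

lemma eq_cliqueMinusSep_of_agreeOn {J : Matrix V V ℝ} (hS : S.IsSymm) (hJ : J ∈ precisions G)
    (h : AgreeOn G J⁻¹ S) : J = cliqueMinusSep F S := by
  have hpd := fun k => block_posDef_of_agreeOn_inv (F := F) hJ.1 h k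
  exact eq_of_agreeOn_inv hJ (cliqueMinusSep_mem_precisions hS hpd)
    (h.trans (agreeOn_inv_cliqueMinusSep hS hpd).symm)

end CliqueForest

variable [DecidableEq V]

lemma continuousAt_localInv {c : Finset V} (h : (block S c).PosDef) (i j : V) :
    ContinuousAt (fun A : Matrix V V ℝ => localInv A c i j) S := by
  unfold localInv
  by_cases hij : i ∈ c ∧ j ∈ c
  · simp only [dif_pos hij]
    have hinv : ContinuousAt (fun A : Matrix V V ℝ => (block A c)⁻¹) S := by
      refine ContinuousAt.comp (g := Inv.inv) (continuousAt_matrix_inv _ ?_)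
        (continuous_id.matrix_submatrix _ _).continuousAt
      rw [Ring.inverse_eq_inv']
      exact continuousAt_inv₀ h.det_pos.ne'
    exact (continuous_id.matrix_elem _ _).continuousAt.comp hinv
  · simp only [dif_neg hij]
    exact continuousAt_const

lemma continuousAt_cliqueMinusSep [Fintype ι] {F : CliqueForest G ι}
    (hpd : ∀ k, (block S (F.C k)).PosDef) : ContinuousAt (cliqueMinusSep F) S := by
  refine continuousAt_pi.2 fun i => continuousAt_pi.2 fun j => ?_
  exact (tendsto_finsetSum _ fun k _ => continuousAt_localInv (hpd k) i j).sub
    (tendsto_finsetSum _ fun e _ => continuousAt_localInv (CliqueForest.sep_posDef hpd e) i j)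

end Completion

section GammaDensity

variable {a r z : ℝ}

lemma integrableOn_gammaPDFReal (ha : 0 < a) (hr : 0 < r) :
    IntegrableOn (gammaPDFReal a r) (Set.Ioi 0) := by
  refine Integrable.integrableOn ?_
  rw [← lintegral_ofReal_ne_top_iff_integrable
    (stronglyMeasurable_gammaPDFReal a r).aestronglyMeasurable
    (Eventually.of_forall (gammaPDFReal_nonneg ha hr))]
  exact (lintegral_gammaPDF_eq_one ha hr).trans_ne ENNReal.one_ne_top

lemma setIntegral_Ioi_gammaPDFReal (ha : 0 < a) (hr : 0 < r) :
    ∫ z in Set.Ioi 0, gammaPDFReal a r z = 1 := by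
  have := Real.Gamma_pos_of_pos ha
  calc ∫ z in Set.Ioi 0, gammaPDFReal a r z
      = ∫ z in Set.Ioi 0, r ^ a / Real.Gamma a * (z ^ (a - 1) * Real.exp (-(r * z))) :=
        setIntegral_congr_fun measurableSet_Ioi fun z hz => by
          rw [gammaPDFReal, if_pos (Set.mem_Ioi.1 hz).le, mul_assoc]
    _ = 1 := by
        rw [integral_const_mul, Real.integral_rpow_mul_exp_neg_mul_Ioi ha hr, one_div,
          Real.inv_rpow hr.le]
        field_simp

lemma mul_gammaPDFReal (ha : 0 < a) (hr : 0 < r) (hz : 0 < z) :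
    z * gammaPDFReal a r z = a / r * gammaPDFReal (a + 1) r z := by
  have := Real.Gamma_pos_of_pos ha
  rw [gammaPDFReal, gammaPDFReal, if_pos hz.le, if_pos hz.le, Real.Gamma_add_one ha.ne',
    Real.rpow_add_one hr.ne', add_sub_cancel_right, Real.rpow_sub_one hz.ne']
  field_simp

lemma integrableOn_mul_gammaPDFReal (ha : 0 < a) (hr : 0 < r) :
    IntegrableOn (fun z => z * gammaPDFReal a r z) (Set.Ioi 0) :=
  IntegrableOn.congr_fun ((integrableOn_gammaPDFReal (by positivity) hr).const_mul (a / r))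
    (fun _ hz => (mul_gammaPDFReal ha hr hz).symm) measurableSet_Ioi

lemma setIntegral_Ioi_mul_gammaPDFReal (ha : 0 < a) (hr : 0 < r) :
    ∫ z in Set.Ioi 0, z * gammaPDFReal a r z = a / r := by
  rw [setIntegral_congr_fun measurableSet_Ioi fun _ hz => mul_gammaPDFReal ha hr hz,
    integral_const_mul, setIntegral_Ioi_gammaPDFReal (by positivity) hr, mul_one]

lemma abs_log_le_add_inv (hz : 0 < z) : |Real.log z| ≤ z + z⁻¹ := by
  have hlog := Real.log_le_sub_one_of_pos hz
  have hlog_inv := Real.log_le_sub_one_of_pos (inv_pos.2 hz)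
  rw [Real.log_inv] at hlog_inv
  exact abs_le.2 ⟨by linarith, by linarith [inv_pos.2 hz]⟩

lemma integrableOn_log_mul_gammaPDFReal (ha : 1 < a) (hr : 0 < r) :
    IntegrableOn (fun z => Real.log z * gammaPDFReal a r z) (Set.Ioi 0) := by
  have ha' : 0 < a - 1 := sub_pos.2 ha
  refine Integrable.mono' ((integrableOn_mul_gammaPDFReal (one_pos.trans ha) hr).add
    ((integrableOn_gammaPDFReal ha' hr).const_mul (r / (a - 1))))
    (Real.measurable_log.mul (measurable_gammaPDFReal a r)).aestronglyMeasurable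
    (ae_restrict_of_forall_mem measurableSet_Ioi fun z hz => ?_)
  have hinv : z⁻¹ * gammaPDFReal a r z = r / (a - 1) * gammaPDFReal (a - 1) r z := by
    have := mul_gammaPDFReal ha' hr hz
    rw [sub_add_cancel] at this
    have hz0 := (Set.mem_Ioi.1 hz).ne'
    field_simp at this ⊢
    linarith
  have hpdf := gammaPDFReal_nonneg (one_pos.trans ha) hr z
  calc ‖Real.log z * gammaPDFReal a r z‖
      = |Real.log z| * gammaPDFReal a r z := by
        rw [Real.norm_eq_abs, abs_mul, abs_of_nonneg hpdf]
    _ ≤ (z + z⁻¹) * gammaPDFReal a r z :=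
        mul_le_mul_of_nonneg_right (abs_log_le_add_inv hz) hpdf
    _ = z * gammaPDFReal a r z + r / (a - 1) * gammaPDFReal (a - 1) r z := by
        rw [add_mul, hinv]

end GammaDensity

section EStep

variable {V : Type*} [Fintype V] {ν : ℝ} {θ η : (V → ℝ) × Matrix V V ℝ}

lemma mahalanobisSq_nonneg (hθ : θ.2.PosDef) (y : V → ℝ) : 0 ≤ mahalanobisSq θ y := by
  have := hθ.posSemidef.dotProduct_mulVec_nonneg (y - θ.1)
  rwa [star_trivial] at this

/-- The shape `(ν + p) / 2` of the conditional Gamma distribution of the latent variable. -/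
def postShape (V : Type*) [Fintype V] (ν : ℝ) : ℝ := (ν + Fintype.card V) / 2

/-- The rate of the conditional Gamma distribution of the latent variable given `y`. -/
def postRate (ν : ℝ) (θ : (V → ℝ) × Matrix V V ℝ) (y : V → ℝ) : ℝ :=
  (ν + ν / (ν - 2) * mahalanobisSq θ y) / 2

lemma one_lt_postShape (hν : 2 < ν) : 1 < postShape V ν := by
  have := Nat.cast_nonneg (α := ℝ) (Fintype.card V)
  rw [postShape]
  linarith

lemma postShape_pos (hν : 2 < ν) : 0 < postShape V ν := one_pos.trans (one_lt_postShape hν)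

lemma postRate_pos (hν : 2 < ν) (hθ : θ.2.PosDef) (y : V → ℝ) : 0 < postRate ν θ y := by
  have hcoef : 0 < ν / (ν - 2) := div_pos (by linarith) (by linarith)
  have := mul_nonneg hcoef.le (mahalanobisSq_nonneg hθ y)
  rw [postRate]
  linarith

lemma studentWeight_eq_div (ν : ℝ) (θ : (V → ℝ) × Matrix V V ℝ) (y : V → ℝ) :
    studentWeight ν θ y = postShape V ν / postRate ν θ y :=
  (div_div_div_cancel_right₀ two_ne_zero _ _).symm

lemma studentWeight_pos (hν : 2 < ν) (hθ : θ.2.PosDef) (y : V → ℝ) : 0 < studentWeight ν θ y := by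
  rw [studentWeight_eq_div]
  exact div_pos (postShape_pos hν) (postRate_pos hν hθ y)

variable [DecidableEq V]

/-- The factor of the joint density that depends neither on the latent variable nor on the
observation. -/
def jointConst (ν : ℝ) (J : Matrix V V ℝ) : ℝ :=
  (ν / 2) ^ (ν / 2) / Real.Gamma (ν / 2) *
    Real.sqrt (ν ^ Fintype.card V * J.det / (2 * Real.pi * (ν - 2)) ^ Fintype.card V)

lemma jointConst_pos (hν : 2 < ν) {J : Matrix V V ℝ} (hJ : J.PosDef) : 0 < jointConst ν J := by
  have hν0 : 0 < ν := by linarith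
  have : 0 < ν - 2 := by linarith
  have := Real.Gamma_pos_of_pos (half_pos hν0)
  have := hJ.det_pos
  unfold jointConst
  positivity

lemma log_jointConst (hν : 2 < ν) {J : Matrix V V ℝ} (hJ : J.PosDef) :
    Real.log (jointConst ν J) =
      Real.log (jointConst ν (1 : Matrix V V ℝ)) + 1 / 2 * Real.log J.det := by
  have : 0 < ν := by linarith
  have : 0 < ν - 2 := by linarith
  have hfactor : jointConst ν J = jointConst ν (1 : Matrix V V ℝ) * Real.sqrt J.det := by
    rw [jointConst, jointConst, det_one, mul_one, mul_div_right_comm,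
      Real.sqrt_mul (by positivity), ← mul_assoc]
  rw [hfactor, Real.log_mul (jointConst_pos hν PosDef.one).ne' (Real.sqrt_pos.2 hJ.det_pos).ne',
    Real.log_sqrt hJ.det_pos.le, one_div_mul_eq_div]

lemma jointDensity_eq (θ : (V → ℝ) × Matrix V V ℝ) (y : V → ℝ) {z : ℝ} (hz : 0 < z) :
    jointDensity ν θ y z = jointConst ν θ.2 *
      (z ^ (postShape V ν - 1) * Real.exp (-(postRate ν θ y * z))) := by
  have hsqrt : Real.sqrt (z ^ Fintype.card V * ν ^ Fintype.card V * θ.2.det /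
      (2 * Real.pi * (ν - 2)) ^ Fintype.card V) = z ^ ((Fintype.card V : ℝ) / 2) *
      Real.sqrt (ν ^ Fintype.card V * θ.2.det / (2 * Real.pi * (ν - 2)) ^ Fintype.card V) := by
    rw [mul_assoc, mul_div_assoc, Real.sqrt_mul (by positivity), Real.sqrt_eq_rpow (z ^ _),
      ← Real.rpow_natCast, ← Real.rpow_mul hz.le, mul_one_div]
  have hpow : z ^ (postShape V ν - 1) = z ^ (ν / 2 - 1) * z ^ ((Fintype.card V : ℝ) / 2) := by
    rw [← Real.rpow_add hz, postShape]
    ring_nf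
  have hexp : Real.exp (-(postRate ν θ y * z)) = Real.exp (-(ν / 2 * z)) *
      Real.exp (-(z / 2 * (ν / (ν - 2)) * mahalanobisSq θ y)) := by
    rw [← Real.exp_add, postRate]
    ring_nf
  rw [jointDensity, gammaPDFReal, if_pos hz.le, normalDensity, hsqrt, hpow, hexp, jointConst]
  ring

lemma log_jointDensity_eq (hν : 2 < ν) (hθ : θ.2.PosDef) (y : V → ℝ) {z : ℝ} (hz : 0 < z) :
    Real.log (jointDensity ν θ y z) =
      Real.log (jointConst ν θ.2) + (postShape V ν - 1) * Real.log z - postRate ν θ y * z := by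
  have hpow := (Real.rpow_pos_of_pos hz (postShape V ν - 1)).ne'
  have hexp := (Real.exp_pos (-(postRate ν θ y * z))).ne'
  rw [jointDensity_eq θ y hz, Real.log_mul (jointConst_pos hν hθ).ne' (mul_ne_zero hpow hexp),
    Real.log_mul hpow hexp, Real.log_exp, Real.log_rpow hz]
  ring

lemma posterior_eqOn_gammaPDFReal (hν : 2 < ν) (hθ : θ.2.PosDef) (y : V → ℝ) :
    Set.EqOn (posterior ν θ y) (gammaPDFReal (postShape V ν) (postRate ν θ y)) (Set.Ioi 0) := by
  have hshape := postShape_pos (V := V) hν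
  have hrate := postRate_pos hν hθ y
  have := Real.Gamma_pos_of_pos hshape
  have hconst := jointConst_pos hν hθ
  have hnorm : ∫ u in Set.Ioi 0, jointDensity ν θ y u = jointConst ν θ.2 *
      ((1 / postRate ν θ y) ^ postShape V ν * Real.Gamma (postShape V ν)) := by
    rw [← Real.integral_rpow_mul_exp_neg_mul_Ioi hshape hrate, ← integral_const_mul]
    exact setIntegral_congr_fun measurableSet_Ioi fun u hu => jointDensity_eq θ y hu
  intro z hz
  rw [posterior, hnorm, jointDensity_eq θ y hz, gammaPDFReal, if_pos (Set.mem_Ioi.1 hz).le,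
    one_div, Real.inv_rpow hrate.le]
  field_simp

theorem emWeight_eq (hν : 2 < ν) (hθ : θ.2.PosDef) (y : V → ℝ) :
    emWeight ν θ y = studentWeight ν θ y := by
  rw [studentWeight_eq_div, ← setIntegral_Ioi_mul_gammaPDFReal (postShape_pos hν)
    (postRate_pos hν hθ y), emWeight]
  exact setIntegral_congr_fun measurableSet_Ioi fun z hz => by
    simp only [posterior_eqOn_gammaPDFReal hν hθ y hz]

/-- The conditional mean of `log z` given the observation `y`. -/
def postMeanLog (ν : ℝ) (θ : (V → ℝ) × Matrix V V ℝ) (y : V → ℝ) : ℝ :=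
  ∫ z in Set.Ioi 0, Real.log z * gammaPDFReal (postShape V ν) (postRate ν θ y) z

lemma setIntegral_posterior_mul_log_jointDensity (hν : 2 < ν) (hη : η.2.PosDef) (hθ : θ.2.PosDef)
    (y : V → ℝ) :
    ∫ z in Set.Ioi 0, posterior ν θ y z * Real.log (jointDensity ν η y z) =
      Real.log (jointConst ν η.2) + (postShape V ν - 1) * postMeanLog ν θ y -
        postRate ν η y * studentWeight ν θ y := by
  have hshape := postShape_pos (V := V) hν
  have hrate := postRate_pos hν hθ y
  set γ := gammaPDFReal (postShape V ν) (postRate ν θ y) with hγ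
  have hint : Integrable γ (volume.restrict (Set.Ioi 0)) := integrableOn_gammaPDFReal hshape hrate
  have hint_log : Integrable (fun z => Real.log z * γ z) (volume.restrict (Set.Ioi 0)) :=
    integrableOn_log_mul_gammaPDFReal (one_lt_postShape hν) hrate
  have hint_mul : Integrable (fun z => z * γ z) (volume.restrict (Set.Ioi 0)) :=
    integrableOn_mul_gammaPDFReal hshape hrate
  calc ∫ z in Set.Ioi 0, posterior ν θ y z * Real.log (jointDensity ν η y z)
      = ∫ z in Set.Ioi 0, (Real.log (jointConst ν η.2) * γ z +
          (postShape V ν - 1) * (Real.log z * γ z) - postRate ν η y * (z * γ z)) := by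
        refine setIntegral_congr_fun measurableSet_Ioi fun z hz => ?_
        simp only [posterior_eqOn_gammaPDFReal hν hθ y hz, log_jointDensity_eq hν hη y hz, ← hγ]
        ring
    _ = _ := by
        rw [integral_sub (by fun_prop) (by fun_prop), integral_add (by fun_prop) (by fun_prop),
          integral_const_mul, integral_const_mul, integral_const_mul,
          setIntegral_Ioi_gammaPDFReal hshape hrate, setIntegral_Ioi_mul_gammaPDFReal hshape hrate,
          studentWeight_eq_div, mul_one, postMeanLog]

variable {q : ℕ}

/-- The part of `Q(η | θ)` that does not depend on `η`. -/
def emConst (ν : ℝ) (x : Fin q → V → ℝ) (θ : (V → ℝ) × Matrix V V ℝ) : ℝ :=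
  ∑ s, (Real.log (jointConst ν (1 : Matrix V V ℝ)) +
    (postShape V ν - 1) * postMeanLog ν θ (x s) - ν / 2 * studentWeight ν θ (x s))

theorem emQ_eq (hν : 2 < ν) (x : Fin q → V → ℝ) (hη : η.2.PosDef) (hθ : θ.2.PosDef) :
    emQ ν x η θ = emConst ν x θ + ((q : ℝ) / 2 * Real.log η.2.det -
      1 / 2 * (ν / (ν - 2)) * ∑ s, studentWeight ν θ (x s) * mahalanobisSq η (x s)) := by
  have hsum : (q : ℝ) / 2 * Real.log η.2.det = ∑ _s : Fin q, 1 / 2 * Real.log η.2.det := by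
    rw [Finset.sum_const, Finset.card_univ, Fintype.card_fin, nsmul_eq_mul, ← mul_assoc,
      mul_one_div]
  rw [emQ, emConst, hsum, Finset.mul_sum, ← Finset.sum_sub_distrib, ← Finset.sum_add_distrib]
  refine Finset.sum_congr rfl fun s _ => ?_
  rw [setIntegral_posterior_mul_log_jointDensity hν hη hθ, log_jointConst hν hη, postRate]
  ring

end EStep

section WeightedMoments

variable {V : Type*} {q : ℕ}

lemma eq_weightedMean_iff {w : Fin q → ℝ} (hw : ∑ s, w s ≠ 0) {x : Fin q → V → ℝ} {m : V → ℝ} :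
    m = weightedMean w x ↔ ∑ s, w s • (x s - m) = 0 := by
  simp only [smul_sub, Finset.sum_sub_distrib, ← Finset.sum_smul]
  rw [sub_eq_zero, weightedMean, eq_inv_smul_iff₀ hw, eq_comm]

lemma weightedCov_eq (w : Fin q → ℝ) (x : Fin q → V → ℝ) (m : V → ℝ) :
    weightedCov w x m = (1 / (q : ℝ)) • ∑ s, w s • vecMulVec (x s - m) (x s - m) := by
  ext i j
  simp only [weightedCov, Matrix.smul_apply, Matrix.sum_apply, vecMulVec_apply, Pi.sub_apply,
    smul_eq_mul]

variable [Fintype V]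

lemma emCov_isSymm (ν : ℝ) (x : Fin q → V → ℝ) (θ : (V → ℝ) × Matrix V V ℝ) (m : V → ℝ) :
    (emCov ν x θ m).IsSymm := by
  simp only [emCov, weightedCov_eq, Matrix.IsSymm, transpose_smul, transpose_sum,
    transpose_vecMulVec]

lemma trace_emCov_mul (ν : ℝ) (x : Fin q → V → ℝ) (θ : (V → ℝ) × Matrix V V ℝ) (m : V → ℝ)
    (H : Matrix V V ℝ) :
    (emCov ν x θ m * H).trace =
      ν / (ν - 2) * (1 / (q : ℝ) * ∑ s, studentWeight ν θ (x s) * mahalanobisSq (m, H) (x s)) := by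
  simp only [emCov, weightedCov_eq, Matrix.smul_mul, Matrix.sum_mul, trace_smul, trace_sum,
    vecMulVec_mul, trace_vecMulVec, smul_eq_mul, mahalanobisSq, dotProduct_mulVec,
    dotProduct_comm _ (_ ᵥ* H)]

lemma dotProduct_mulVec_comm {J : Matrix V V ℝ} (hJ : J.IsSymm) (u v : V → ℝ) :
    u ⬝ᵥ (J *ᵥ v) = v ⬝ᵥ (J *ᵥ u) := by
  rw [← dotProduct_transpose_mulVec, hJ.eq]

lemma mahalanobisSq_eq_add_add {J : Matrix V V ℝ} (hJ : J.IsSymm) (a m y : V → ℝ) :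
    mahalanobisSq (a, J) y =
      mahalanobisSq (m, J) y + 2 * ((m - a) ⬝ᵥ (J *ᵥ (y - m))) + mahalanobisSq (a, J) m := by
  simp only [mahalanobisSq]
  rw [← sub_add_sub_cancel y m a, mulVec_add, dotProduct_add, add_dotProduct, add_dotProduct,
    dotProduct_mulVec_comm hJ (y - m) (m - a)]
  ring

lemma sum_mul_mahalanobisSq {J : Matrix V V ℝ} (hJ : J.IsSymm) {w : Fin q → ℝ}
    {x : Fin q → V → ℝ} {m : V → ℝ} (hm : ∑ s, w s • (x s - m) = 0) (a : V → ℝ) :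
    ∑ s, w s * mahalanobisSq (a, J) (x s) =
      ∑ s, w s * mahalanobisSq (m, J) (x s) + (∑ s, w s) * mahalanobisSq (a, J) m := by
  have hcross : ∑ s, w s * ((m - a) ⬝ᵥ (J *ᵥ (x s - m))) = 0 := by
    calc ∑ s, w s * ((m - a) ⬝ᵥ (J *ᵥ (x s - m)))
        = (m - a) ⬝ᵥ (J *ᵥ ∑ s, w s • (x s - m)) := by
          simp only [mulVec_sum, dotProduct_sum, mulVec_smul, dotProduct_smul, smul_eq_mul]
      _ = 0 := by rw [hm, mulVec_zero, dotProduct_zero]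
  rw [Finset.sum_congr rfl fun s _ => congrArg (w s * ·) (mahalanobisSq_eq_add_add hJ a m (x s))]
  simp only [mul_add, Finset.sum_add_distrib, mul_left_comm _ (2 : ℝ), ← Finset.mul_sum, hcross,
    mul_zero, add_zero, ← Finset.sum_mul]

lemma mahalanobisSq_pos {J : Matrix V V ℝ} (hJ : J.PosDef) {a y : V → ℝ} (h : a ≠ y) :
    0 < mahalanobisSq (a, J) y := by
  have := hJ.dotProduct_mulVec_pos (sub_ne_zero.2 h.symm)
  rwa [star_trivial] at this

end WeightedMoments

section MStep

variable {V ι : Type*} [Fintype V] {q : ℕ} {G : SimpleGraph V} {ν : ℝ} {x : Fin q → V → ℝ}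
  {θ θ' : (V → ℝ) × Matrix V V ℝ} {a : V → ℝ} {J K : Matrix V V ℝ}

/-- The mean of the observations with the weights computed at `θ`: the location produced by an EM
update of `θ`. -/
def emMean (ν : ℝ) (x : Fin q → V → ℝ) (θ : (V → ℝ) × Matrix V V ℝ) : V → ℝ :=
  weightedMean (fun s => studentWeight ν θ (x s)) x

lemma sum_studentWeight_pos (hν : 2 < ν) (hq : 0 < q) (x : Fin q → V → ℝ) (hθ : θ.2.PosDef) :
    0 < ∑ s, studentWeight ν θ (x s) :=
  Finset.sum_pos (fun s _ => studentWeight_pos hν hθ (x s)) ⟨⟨0, hq⟩, Finset.mem_univ _⟩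

lemma eq_emMean_iff (hν : 2 < ν) (hq : 0 < q) (hθ : θ.2.PosDef) :
    a = emMean ν x θ ↔ ∑ s, studentWeight ν θ (x s) • (x s - a) = 0 :=
  eq_weightedMean_iff (sum_studentWeight_pos hν hq x hθ).ne'

variable [DecidableEq V]

/-- The moment conditions characterizing an EM update `θ'` of `θ` whose covariances are taken
around `a`. A joint update has `a = emMean ν x θ`, a separate update `a = θ.1`. -/
structure IsMomentUpdate (G : SimpleGraph V) (ν : ℝ) (x : Fin q → V → ℝ)
    (θ : (V → ℝ) × Matrix V V ℝ) (a : V → ℝ) (θ' : (V → ℝ) × Matrix V V ℝ) : Prop where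
  mem_params : θ' ∈ params G
  mean_eq : θ'.1 = emMean ν x θ
  agreeOn : AgreeOn G θ'.2⁻¹ (emCov ν x θ a)

/-- Stationarity of the EM iteration: `θ` satisfies its own moment conditions. -/
def IsMomentMatched (G : SimpleGraph V) (ν : ℝ) (x : Fin q → V → ℝ)
    (θ : (V → ℝ) × Matrix V V ℝ) : Prop :=
  θ.1 = emMean ν x θ ∧ AgreeOn G θ.2⁻¹ (emCov ν x θ θ.1)

lemma emQ_eq_emConst_add_gaussObj (hν : 2 < ν) (hq : 0 < q) (x : Fin q → V → ℝ)
    {η : (V → ℝ) × Matrix V V ℝ} (hη : η.2.PosDef) (hθ : θ.2.PosDef) :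
    emQ ν x η θ = emConst ν x θ + (q : ℝ) / 2 * gaussObj (emCov ν x θ η.1) η.2 := by
  rw [emQ_eq hν x hη hθ, gaussObj, trace_emCov_mul]
  field_simp

lemma emQ_le_emQ_iff_gaussObj_le (hν : 2 < ν) (hq : 0 < q) (hJ : J.PosDef) (hK : K.PosDef)
    (hθ : θ.2.PosDef) :
    emQ ν x (a, K) θ ≤ emQ ν x (a, J) θ ↔
      gaussObj (emCov ν x θ a) K ≤ gaussObj (emCov ν x θ a) J := by
  have hq2 : (0 : ℝ) < q / 2 := by positivity
  rw [emQ_eq_emConst_add_gaussObj hν hq x (η := (a, K)) hK hθ,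
    emQ_eq_emConst_add_gaussObj hν hq x (η := (a, J)) hJ hθ, add_le_add_iff_left,
    mul_le_mul_iff_right₀ hq2]

lemma emQ_eq_emQ_emMean_sub (hν : 2 < ν) (hq : 0 < q) (hJ : J.PosDef) (hθ : θ.2.PosDef)
    (a : V → ℝ) :
    emQ ν x (a, J) θ = emQ ν x (emMean ν x θ, J) θ - 1 / 2 * (ν / (ν - 2)) *
      ((∑ s, studentWeight ν θ (x s)) * mahalanobisSq (a, J) (emMean ν x θ)) := by
  rw [emQ_eq hν x (η := (a, J)) hJ hθ, emQ_eq hν x (η := (emMean ν x θ, J)) hJ hθ,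
    sum_mul_mahalanobisSq (isSymm_of_posDef hJ) ((eq_emMean_iff hν hq hθ).1 rfl) a]
  ring

lemma emQ_lt_emQ_emMean (hν : 2 < ν) (hq : 0 < q) (hJ : J.PosDef) (hθ : θ.2.PosDef)
    (ha : a ≠ emMean ν x θ) : emQ ν x (a, J) θ < emQ ν x (emMean ν x θ, J) θ := by
  have : 0 < ν / (ν - 2) := div_pos (by linarith) (by linarith)
  have := sum_studentWeight_pos hν hq x hθ
  have := mahalanobisSq_pos hJ ha
  rw [emQ_eq_emQ_emMean_sub hν hq hJ hθ a, sub_lt_self_iff]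
  positivity

lemma emQ_le_emQ_emMean (hν : 2 < ν) (hq : 0 < q) (hJ : J.PosDef) (hθ : θ.2.PosDef)
    (a : V → ℝ) : emQ ν x (a, J) θ ≤ emQ ν x (emMean ν x θ, J) θ := by
  rcases eq_or_ne a (emMean ν x θ) with rfl | ha
  · rfl
  · exact (emQ_lt_emQ_emMean hν hq hJ hθ ha).le

lemma eq_emMean_of_emQ_le (hν : 2 < ν) (hq : 0 < q) (hJ : J.PosDef) (hθ : θ.2.PosDef)
    (h : emQ ν x (emMean ν x θ, J) θ ≤ emQ ν x (a, J) θ) : a = emMean ν x θ :=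
  not_imp_comm.1 (emQ_lt_emQ_emMean hν hq hJ hθ) h.not_gt

lemma agreeOn_inv_emCov_iff (hν : 2 < ν) (hq : 0 < q) (hJ : J ∈ precisions G) (hθ : θ.2.PosDef) :
    AgreeOn G J⁻¹ (emCov ν x θ a) ↔
      ∀ K ∈ precisions G, emQ ν x (a, K) θ ≤ emQ ν x (a, J) θ := by
  constructor
  · intro h K hK
    exact (emQ_le_emQ_iff_gaussObj_le hν hq hJ.1 hK.1 hθ).2 (gaussObj_le_of_agreeOn hJ hK h)
  · intro h
    refine agreeOn_of_forall_gaussObj_le (emCov_isSymm ν x θ a) hJ fun K hK => ?_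
    exact (emQ_le_emQ_iff_gaussObj_le hν hq hJ.1 hK.1 hθ).1 (h K hK)

theorem isEMStep_iff (hν : 2 < ν) (hq : 0 < q) (hθ : θ.2.PosDef) :
    IsEMStep G ν x θ θ' ↔ IsMomentUpdate G ν x θ (emMean ν x θ) θ' := by
  constructor
  · rintro ⟨hmem, hmax⟩
    have hmean := eq_emMean_of_emQ_le hν hq hmem.1 hθ (hmax (_, θ'.2) hmem)
    refine ⟨hmem, hmean, (agreeOn_inv_emCov_iff hν hq hmem hθ).2 fun K hK => ?_⟩
    rw [← hmean]
    exact hmax (θ'.1, K) hK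
  · rintro ⟨hmem, hmean, hagree⟩
    refine ⟨hmem, fun η hη => (emQ_le_emQ_emMean hν hq hη.1 hθ η.1).trans ?_⟩
    have := (agreeOn_inv_emCov_iff hν hq hmem hθ).1 hagree η.2 hη
    rwa [← hmean] at this ⊢

theorem isSeparateEMStep_iff (hν : 2 < ν) (hq : 0 < q) (hθ : θ.2.PosDef) :
    IsSeparateEMStep G ν x θ θ' ↔ IsMomentUpdate G ν x θ θ.1 θ' := by
  constructor
  · rintro ⟨hmem, hmax_mean, hmax⟩
    exact ⟨hmem, eq_emMean_of_emQ_le hν hq hmem.1 hθ (hmax_mean _),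
      (agreeOn_inv_emCov_iff hν hq hmem hθ).2 fun K hK => hmax (θ.1, K) hK⟩
  · rintro ⟨hmem, hmean, hagree⟩
    refine ⟨hmem, fun m => ?_, fun η hη => (agreeOn_inv_emCov_iff hν hq hmem hθ).1 hagree η.2 hη⟩
    have := emQ_le_emQ_emMean (x := x) hν hq hmem.1 hθ m
    rwa [← hmean] at this

lemma isMomentUpdate_self_iff (hθ : θ ∈ params G) :
    IsMomentUpdate G ν x θ θ.1 θ ↔ IsMomentMatched G ν x θ :=
  ⟨fun h => ⟨h.mean_eq, h.agreeOn⟩, fun h => ⟨hθ, h.1, h.2⟩⟩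

theorem isSeparateEMStep_self_iff (hν : 2 < ν) (hq : 0 < q) (hθ : θ ∈ params G) :
    IsSeparateEMStep G ν x θ θ ↔ IsMomentMatched G ν x θ := by
  rw [isSeparateEMStep_iff hν hq hθ.1, isMomentUpdate_self_iff hθ]

theorem isEMStep_self_iff (hν : 2 < ν) (hq : 0 < q) (hθ : θ ∈ params G) :
    IsEMStep G ν x θ θ ↔ IsMomentMatched G ν x θ := by
  rw [isEMStep_iff hν hq hθ.1, ← isMomentUpdate_self_iff hθ]
  constructor <;> intro h <;> simpa only [← h.mean_eq] using h

variable [Fintype ι]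

theorem solvesEquations_iff (F : CliqueForest G ι) (hθ : θ ∈ params G) :
    SolvesEquations F ν x θ ↔ IsMomentMatched G ν x θ := by
  have hS := emCov_isSymm ν x θ θ.1
  constructor
  · intro h
    have hJ : θ.2 = cliqueMinusSep F (emCov ν x θ θ.1) := by
      ext i j
      by_cases hij : ∃ k, i ∈ F.C k ∧ j ∈ F.C k
      · exact h.entry_eq i j hij
      · rw [h.entry_zero i j hij, CliqueForest.cliqueMinusSep_apply_eq_zero hij]
    refine ⟨h.mean_eq, ?_⟩
    rw [hJ]
    exact CliqueForest.agreeOn_inv_cliqueMinusSep hS h.clique_posDef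
  · rintro ⟨hmean, hagree⟩
    have hpd := CliqueForest.block_posDef_of_agreeOn_inv (F := F) hθ.1 hagree
    have hJ := CliqueForest.eq_cliqueMinusSep_of_agreeOn (F := F) hS hθ hagree
    refine ⟨hmean, hpd, fun e _ => CliqueForest.sep_posDef hpd e,
      fun i j _ => congrFun₂ hJ i j, fun i j hij => ?_⟩
    rw [hJ, CliqueForest.cliqueMinusSep_apply_eq_zero hij]

lemma isMomentUpdate_iff_eq (F : CliqueForest G ι)
    (hpd : ∀ k, (block (emCov ν x θ a) (F.C k)).PosDef) :
    IsMomentUpdate G ν x θ a θ' ↔ θ' = (emMean ν x θ, cliqueMinusSep F (emCov ν x θ a)) := by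
  have hS := emCov_isSymm ν x θ a
  constructor
  · intro h
    exact Prod.ext h.mean_eq
      (CliqueForest.eq_cliqueMinusSep_of_agreeOn hS h.mem_params h.agreeOn)
  · rintro rfl
    exact ⟨CliqueForest.cliqueMinusSep_mem_precisions hS hpd, rfl,
      CliqueForest.agreeOn_inv_cliqueMinusSep hS hpd⟩

end MStep

section Stationary

variable {V : Type*} [Fintype V] {q : ℕ} {ν : ℝ} {θ η : (V → ℝ) × Matrix V V ℝ}

/-- The contribution of an observation `y` to the negative log-likelihood. -/
def studentPenalty (ν : ℝ) (θ : (V → ℝ) × Matrix V V ℝ) (y : V → ℝ) : ℝ :=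
  (ν + Fintype.card V) / 2 * Real.log (1 + 1 / (ν - 2) * mahalanobisSq θ y)

lemma one_add_mahalanobisSq_pos (hν : 2 < ν) (hθ : θ.2.PosDef) (y : V → ℝ) :
    0 < 1 + 1 / (ν - 2) * mahalanobisSq θ y := by
  have := mahalanobisSq_nonneg hθ y
  have : 0 < ν - 2 := by linarith
  positivity

/-- The weights are, up to a constant, the derivatives of the penalty with respect to the
Mahalanobis distance. -/
lemma half_mul_div_eq_studentWeight_mul (hν : 2 < ν) (hθ : θ.2.PosDef) (y : V → ℝ) (b : ℝ) :
    (ν + Fintype.card V) / 2 * (1 / (ν - 2) * b / (1 + 1 / (ν - 2) * mahalanobisSq θ y)) =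
      1 / 2 * (ν / (ν - 2)) * (studentWeight ν θ y * b) := by
  have hν0 : ν ≠ 0 := by linarith
  have hden : ν + ν / (ν - 2) * mahalanobisSq θ y =
      ν * (1 + 1 / (ν - 2) * mahalanobisSq θ y) := by ring
  have hpos := (one_add_mahalanobisSq_pos hν hθ y).ne'
  rw [studentWeight, hden]
  generalize 1 + 1 / (ν - 2) * mahalanobisSq θ y = D at hpos ⊢
  field_simp

/-- As `log` is concave, the penalty lies below its tangent as a function of the Mahalanobis
distance. -/
lemma studentPenalty_sub_le (hν : 2 < ν) (hθ : θ.2.PosDef) (hη : η.2.PosDef) (y : V → ℝ) :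
    studentPenalty ν η y - studentPenalty ν θ y ≤ 1 / 2 * (ν / (ν - 2)) *
      (studentWeight ν θ y * (mahalanobisSq η y - mahalanobisSq θ y)) := by
  have hposθ := one_add_mahalanobisSq_pos hν hθ y
  have hposη := one_add_mahalanobisSq_pos hν hη y
  have hlog := Real.log_le_sub_one_of_pos (div_pos hposη hposθ)
  rw [Real.log_div hposη.ne' hposθ.ne', div_sub_one hposθ.ne', add_sub_add_left_eq_sub,
    ← mul_sub] at hlog
  rw [studentPenalty, studentPenalty, ← mul_sub, ← half_mul_div_eq_studentWeight_mul hν hθ]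
  exact mul_le_mul_of_nonneg_left hlog (by positivity)

lemma hasDerivAt_mahalanobisSq (hθ : θ.2.IsSymm) (h : V → ℝ) (H : Matrix V V ℝ) (y : V → ℝ) :
    HasDerivAt (fun t : ℝ => mahalanobisSq (θ.1 + t • h, θ.2 + t • H) y)
      (mahalanobisSq (θ.1, H) y - 2 * (h ⬝ᵥ (θ.2 *ᵥ (y - θ.1)))) 0 := by
  set u := y - θ.1 with hu
  have hexpand (t : ℝ) : mahalanobisSq (θ.1 + t • h, θ.2 + t • H) y =
      u ⬝ᵥ (θ.2 *ᵥ u) + t * (u ⬝ᵥ (H *ᵥ u) - 2 * (h ⬝ᵥ (θ.2 *ᵥ u)) +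
        t * (h ⬝ᵥ (θ.2 *ᵥ h) - h ⬝ᵥ (H *ᵥ u) - u ⬝ᵥ (H *ᵥ h) + t * (h ⬝ᵥ (H *ᵥ h)))) := by
    simp only [mahalanobisSq, ← sub_sub, ← hu, mulVec_sub, add_mulVec, dotProduct_sub,
      sub_dotProduct, mulVec_smul, dotProduct_smul, smul_dotProduct, dotProduct_add, smul_mulVec,
      smul_eq_mul]
    rw [dotProduct_mulVec_comm hθ u h]
    ring
  simp only [hexpand]
  have hid := hasDerivAt_id (0 : ℝ)
  refine ((hid.mul (((hid.mul ((hid.mul_const _).const_add _))).const_add _)).const_add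
    _).congr_deriv ?_
  simp [mahalanobisSq, ← hu]

lemma hasDerivAt_studentPenalty (hν : 2 < ν) (hθ : θ.2.PosDef) (h : V → ℝ) (H : Matrix V V ℝ)
    (y : V → ℝ) :
    HasDerivAt (fun t : ℝ => studentPenalty ν (θ.1 + t • h, θ.2 + t • H) y)
      (1 / 2 * (ν / (ν - 2)) * (studentWeight ν θ y *
        (mahalanobisSq (θ.1, H) y - 2 * (h ⬝ᵥ (θ.2 *ᵥ (y - θ.1)))))) 0 := by
  have hbase : (θ.1 + (0 : ℝ) • h, θ.2 + (0 : ℝ) • H) = θ := by simp only [zero_smul, add_zero]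
  have hinner := ((hasDerivAt_mahalanobisSq (isSymm_of_posDef hθ) h H y).const_mul
    (1 / (ν - 2))).const_add 1
  have hlog := hinner.log (by rw [hbase]; exact (one_add_mahalanobisSq_pos hν hθ y).ne')
  rw [hbase] at hlog
  rw [← half_mul_div_eq_studentWeight_mul hν hθ]
  exact hlog.const_mul _

variable [DecidableEq V] {G : SimpleGraph V} {x : Fin q → V → ℝ}

lemma exists_forall_logLik_eq (ν : ℝ) (x : Fin q → V → ℝ) :
    ∃ C, ∀ θ : (V → ℝ) × Matrix V V ℝ, logLik ν x θ =
      C + ((q : ℝ) / 2 * Real.log θ.2.det - ∑ s, studentPenalty ν θ (x s)) :=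
  ⟨_, fun θ => by rw [logLik, Finset.mul_sum, add_sub_assoc]; rfl⟩

lemma hasDerivAt_logLik (hν : 2 < ν) (hq : 0 < q) (x : Fin q → V → ℝ) (hθ : θ.2.PosDef)
    (h : V → ℝ) (H : Matrix V V ℝ) :
    HasDerivAt (fun t : ℝ => logLik ν x (θ.1 + t • h, θ.2 + t • H))
      ((q : ℝ) / 2 * ((θ.2⁻¹ * H).trace - (emCov ν x θ θ.1 * H).trace) +
        ν / (ν - 2) * (h ⬝ᵥ (θ.2 *ᵥ ∑ s, studentWeight ν θ (x s) • (x s - θ.1)))) 0 := by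
  obtain ⟨C, hC⟩ := exists_forall_logLik_eq ν x
  simp only [hC]
  refine ((((hasDerivAt_log_det_add_smul hθ H).const_mul _).sub
    (HasDerivAt.fun_sum fun s (_ : s ∈ Finset.univ) =>
      hasDerivAt_studentPenalty hν hθ h H (x s))).const_add C).congr_deriv ?_
  simp only [trace_emCov_mul, mulVec_sum, dotProduct_sum, mulVec_smul, dotProduct_smul,
    smul_eq_mul, mul_sub, Finset.sum_sub_distrib, ← Finset.mul_sum, mul_left_comm _ (2 : ℝ)]
  field_simp
  ring

theorem isStationary_iff (hν : 2 < ν) (hq : 0 < q) (hθ : θ ∈ params G) :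
    IsStationary G ν x θ ↔ IsMomentMatched G ν x θ := by
  have hcoef : ν / (ν - 2) ≠ 0 := div_ne_zero (by linarith) (by linarith)
  have hderiv := hasDerivAt_logLik hν hq x hθ.1
  rw [IsMomentMatched, eq_emMean_iff hν hq hθ.1]
  constructor
  · refine fun hstat => ⟨?_, ?_⟩
    · set g := ∑ s, studentWeight ν θ (x s) • (x s - θ.1)
      have hzero := (hderiv g 0).unique (hstat g 0 isSymm_zero fun _ _ _ _ => rfl)
      rw [Matrix.mul_zero, Matrix.mul_zero, sub_self, mul_zero, zero_add] at hzero
      by_contra hne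
      have hpos := hθ.1.dotProduct_mulVec_pos hne
      rw [star_trivial] at hpos
      exact (mul_ne_zero hcoef hpos.ne') hzero
    · refine agreeOn_of_trace_mul_eq (isSymm_of_posDef hθ.1.inv) (emCov_isSymm ν x θ θ.1)
        fun H hH hsparse => ?_
      have hzero := (hderiv 0 H).unique (hstat 0 H hH hsparse)
      rw [zero_dotProduct, mul_zero, add_zero] at hzero
      exact sub_eq_zero.1 ((mul_eq_zero.1 hzero).resolve_left (by positivity))
  · rintro ⟨hmean, hagree⟩ h H - hsparse
    refine (hderiv h H).congr_deriv ?_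
    rw [hmean, hagree.trace_mul_eq hsparse, sub_self, mul_zero, mulVec_zero, dotProduct_zero,
      mul_zero, add_zero]

theorem emQ_sub_le_logLik_sub (hν : 2 < ν) (x : Fin q → V → ℝ) (hθ : θ.2.PosDef)
    (hη : η.2.PosDef) : emQ ν x η θ - emQ ν x θ θ ≤ logLik ν x η - logLik ν x θ := by
  obtain ⟨C, hC⟩ := exists_forall_logLik_eq ν x
  have hsum := Finset.sum_le_sum fun s (_ : s ∈ Finset.univ) =>
    studentPenalty_sub_le hν hθ hη (x s)
  simp only [mul_sub, Finset.sum_sub_distrib, ← Finset.mul_sum] at hsum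
  rw [emQ_eq hν x hη hθ, emQ_eq hν x hθ hθ, hC, hC]
  linarith

theorem IsMLSolution.isEMStep_self (hν : 2 < ν) (h : IsMLSolution G ν x θ) :
    IsEMStep G ν x θ θ :=
  ⟨h.1, fun η hη => by linarith [emQ_sub_le_logLik_sub hν x h.1.1 hη.1, h.2 η hη]⟩

end Stationary

section SampleCov

variable {V : Type*} {q : ℕ} {x : Fin q → V → ℝ} {w w' : Fin q → ℝ} {a : V → ℝ}

lemma dotProduct_weightedCov_mulVec [Fintype V] (w : Fin q → ℝ) (x : Fin q → V → ℝ) (a v : V → ℝ) :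
    v ⬝ᵥ (weightedCov w x a *ᵥ v) = 1 / (q : ℝ) * ∑ s, w s * (v ⬝ᵥ (x s - a)) ^ 2 := by
  simp only [weightedCov_eq, smul_mulVec, sum_mulVec, vecMulVec_mulVec, dotProduct_smul,
    dotProduct_sum, smul_eq_mul, op_smul_eq_smul, dotProduct_comm _ v, ← sq]

lemma weightedCov_posDef_iff [Fintype V] (hq : 0 < q) (hw : ∀ s, 0 < w s) :
    (weightedCov w x a).PosDef ↔ ∀ v ≠ 0, ∃ s, v ⬝ᵥ (x s - a) ≠ 0 := by
  have hq' : (0 : ℝ) < 1 / q := by positivity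
  have hterm (v : V → ℝ) (s : Fin q) : 0 ≤ w s * (v ⬝ᵥ (x s - a)) ^ 2 :=
    mul_nonneg (hw s).le (sq_nonneg _)
  have hsymm : (weightedCov w x a).IsHermitian := by
    simp only [isHermitian_iff_isSymm, weightedCov_eq, Matrix.IsSymm, transpose_smul,
      transpose_sum, transpose_vecMulVec]
  simp only [posDef_iff_dotProduct_mulVec, hsymm, true_and, star_trivial,
    dotProduct_weightedCov_mulVec, mul_pos_iff_of_pos_left hq',
    Finset.sum_pos_iff_of_nonneg fun s _ => hterm _ s, Finset.mem_univ,
    mul_pos_iff_of_pos_left (hw _), sq_pos_iff]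

lemma dotProduct_weightedMean [Fintype V] (hw : ∑ s, w s ≠ 0) {v : V → ℝ} {r : ℝ}
    (h : ∀ s, v ⬝ᵥ x s = r) : v ⬝ᵥ weightedMean w x = r := by
  simp only [weightedMean, dotProduct_smul, dotProduct_sum, h, smul_eq_mul, ← Finset.sum_mul]
  exact inv_mul_cancel_left₀ hw r

lemma weightedCov_posDef_of_weightedMean [Finite V] (hq : 0 < q) (hw : ∀ s, 0 < w s)
    (hw' : ∀ s, 0 < w' s) (h : (weightedCov w' x (weightedMean w' x)).PosDef)
    (a : V → ℝ) : (weightedCov w x a).PosDef := by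
  cases nonempty_fintype V
  have hsum : ∑ s, w' s ≠ 0 := (Finset.sum_pos (fun s _ => hw' s) ⟨⟨0, hq⟩, Finset.mem_univ _⟩).ne'
  rw [weightedCov_posDef_iff hq hw'] at h
  refine (weightedCov_posDef_iff hq hw).2 fun v hv => ?_
  by_contra! hconst
  obtain ⟨s, hs⟩ := h v hv
  simp only [dotProduct_sub, sub_eq_zero] at hconst
  exact hs (by rw [dotProduct_sub, hconst s, dotProduct_weightedMean hsum hconst, sub_self])

lemma block_emCov_posDef [Fintype V] {ν : ℝ} (hν : 2 < ν) (hq : 0 < q) {θ : (V → ℝ) × Matrix V V ℝ}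
    (hθ : θ.2.PosDef) {c : Finset V}
    (h : (block (weightedCov 1 x (weightedMean 1 x)) c).PosDef) (a : V → ℝ) :
    (block (emCov ν x θ a) c).PosDef := by
  have hcoef : 0 < ν / (ν - 2) := div_pos (by linarith) (by linarith)
  have hmean : c.restrict (weightedMean 1 x) = weightedMean 1 fun s => c.restrict (x s) := by
    ext i
    simp only [weightedMean, Finset.restrict, Pi.smul_apply, Finset.sum_apply]
  have hsample : (weightedCov 1 (fun s => c.restrict (x s))
      (weightedMean 1 fun s => c.restrict (x s))).PosDef := hmean ▸ h
  exact (weightedCov_posDef_of_weightedMean hq (fun s => studentWeight_pos hν hθ (x s))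
    (fun _ => one_pos) hsample (c.restrict a)).smul hcoef

end SampleCov

section Limits

variable {V α : Type*} [Fintype V] {q : ℕ} {ν : ℝ} {x : Fin q → V → ℝ} {l : Filter α}
  {θ η : (V → ℝ) × Matrix V V ℝ} {f g : α → (V → ℝ) × Matrix V V ℝ} {a : α → V → ℝ}
  {a' : V → ℝ}

lemma continuous_mahalanobisSq (y : V → ℝ) :
    Continuous fun θ : (V → ℝ) × Matrix V V ℝ => mahalanobisSq θ y := by
  unfold mahalanobisSq
  fun_prop

lemma continuousAt_studentWeight (hν : 2 < ν) (hθ : θ.2.PosDef) (y : V → ℝ) :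
    ContinuousAt (fun η => studentWeight ν η y) θ := by
  have : 0 < ν := by linarith
  have : 0 < ν - 2 := by linarith
  have := mahalanobisSq_nonneg hθ y
  exact continuousAt_const.div (((continuous_mahalanobisSq y).const_mul _).const_add
    _).continuousAt (by positivity)

lemma continuousAt_emMean (hν : 2 < ν) (hq : 0 < q) (hθ : θ.2.PosDef) :
    ContinuousAt (emMean ν x) θ := by
  have hweight (s : Fin q) := continuousAt_studentWeight hν hθ (x s)
  refine ContinuousAt.smul (ContinuousAt.inv₀ (tendsto_finsetSum _ fun s _ => hweight s)
    (sum_studentWeight_pos hν hq x hθ).ne') ?_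
  exact tendsto_finsetSum _ fun s _ => (hweight s).smul continuousAt_const

lemma tendsto_emCov (hν : 2 < ν) (hθ : θ.2.PosDef) (hf : Tendsto f l (𝓝 θ))
    (ha : Tendsto a l (𝓝 a')) :
    Tendsto (fun t => emCov ν x (f t) (a t)) l (𝓝 (emCov ν x θ a')) := by
  refine Tendsto.const_smul ?_ _
  refine tendsto_pi_nhds.2 fun i => tendsto_pi_nhds.2 fun j => ?_
  refine Tendsto.const_mul _ (tendsto_finsetSum _ fun s _ => ?_)
  exact ((continuousAt_studentWeight hν hθ (x s)).tendsto.comp hf).mul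
    (((ha.apply_nhds i).const_sub _).mul ((ha.apply_nhds j).const_sub _))

variable [DecidableEq V]

lemma continuousAt_logLik (hν : 2 < ν) (x : Fin q → V → ℝ) (hθ : θ.2.PosDef) :
    ContinuousAt (logLik ν x) θ := by
  refine ((continuous_snd.matrix_det.continuousAt.log hθ.det_pos.ne').const_mul _ |>.const_add
    _).sub (Tendsto.const_mul _ (tendsto_finsetSum _ fun s _ => ?_))
  exact (((continuous_mahalanobisSq (x s)).const_mul _).const_add _).continuousAt.log
    (one_add_mahalanobisSq_pos hν hθ (x s)).ne'

lemma tendsto_gaussObj_emCov (hν : 2 < ν) (hθ : θ.2.PosDef) (hη : η.2.PosDef)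
    (hf : Tendsto f l (𝓝 θ)) (hg : Tendsto g l (𝓝 η)) :
    Tendsto (fun t => gaussObj (emCov ν x (f t) (g t).1) (g t).2) l
      (𝓝 (gaussObj (emCov ν x θ η.1) η.2)) := by
  have hlog := ((continuous_id.matrix_det.tendsto η.2).comp hg.snd_nhds).log hη.det_pos.ne'
  have hcov := (tendsto_emCov (x := x) hν hθ hf hg.fst_nhds).mul hg.snd_nhds
  exact hlog.sub ((continuous_id.matrix_trace.tendsto _).comp hcov)

lemma tendsto_emQ_sub (hν : 2 < ν) (hq : 0 < q) (hθ : θ.2.PosDef) (hη : η.2.PosDef)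
    (hfp : ∀ t, (f t).2.PosDef) (hgp : ∀ t, (g t).2.PosDef) (hf : Tendsto f l (𝓝 θ))
    (hg : Tendsto g l (𝓝 η)) :
    Tendsto (fun t => emQ ν x (g t) (f t) - emQ ν x (f t) (f t)) l
      (𝓝 (emQ ν x η θ - emQ ν x θ θ)) := by
  have hdiff {θ η : (V → ℝ) × Matrix V V ℝ} (hθ : θ.2.PosDef) (hη : η.2.PosDef) :
      emQ ν x η θ - emQ ν x θ θ = (q : ℝ) / 2 * gaussObj (emCov ν x θ η.1) η.2 -
        (q : ℝ) / 2 * gaussObj (emCov ν x θ θ.1) θ.2 := by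
    rw [emQ_eq_emConst_add_gaussObj hν hq x hη hθ, emQ_eq_emConst_add_gaussObj hν hq x hθ hθ,
      add_sub_add_left_eq_sub]
  simp only [hdiff hθ hη, hdiff (hfp _) (hgp _)]
  exact ((tendsto_gaussObj_emCov hν hθ hη hf hg).const_mul _).sub
    ((tendsto_gaussObj_emCov hν hθ hθ hf hf).const_mul _)

end Limits

section LimitPoints

lemma tendsto_atTop_of_monotone_of_le {ι β : Type*} [Preorder ι] [LinearOrder β]
    [TopologicalSpace β] [OrderTopology β] {f : ι → β} (hf : Monotone f) {l : Filter ι} [l.NeBot]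
    (hl : l ≤ atTop) {b : β} (hb : Tendsto f l (𝓝 b)) : Tendsto f atTop (𝓝 b) := by
  refine tendsto_atTop_isLUB hf ⟨?_, fun c hc => ?_⟩
  · rintro _ ⟨t, rfl⟩
    exact ge_of_tendsto hb (((eventually_ge_atTop t).filter_mono hl).mono fun _ hs => hf hs)
  · exact le_of_tendsto hb (Eventually.of_forall fun s => hc ⟨s, rfl⟩)

lemma frequently_and_not_succ {P : ℕ → Prop} (hP : ∃ᶠ t in atTop, P t)
    (hnot : ∃ᶠ t in atTop, ¬ P t) : ∃ᶠ t in atTop, P t ∧ ¬ P (t + 1) := by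
  intro hstay
  obtain ⟨T, hT⟩ := eventually_atTop.1 hstay
  obtain ⟨t, hTt, hPt⟩ := frequently_atTop.1 hP T
  obtain ⟨t', htt', hPt'⟩ := frequently_atTop.1 hnot t
  refine hPt' (Nat.le_induction hPt (fun n hn hPn => ?_) t' htt')
  exact not_not.1 fun hPn' => hT n (hTt.trans hn) ⟨hPn, hPn'⟩

lemma exists_ultrafilter_tendsto_of_frequently {X : Type*} [TopologicalSpace X] {u : ℕ → X}
    {K : Set X} (hK : IsCompact K) (hu : ∀ t, u t ∈ K) {P : ℕ → Prop}
    (hP : ∃ᶠ t in atTop, P t) :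
    ∃ U : Ultrafilter ℕ, (U : Filter ℕ) ≤ atTop ∧ (∀ᶠ t in U, P t) ∧
      ∃ b ∈ K, Tendsto u U (𝓝 b) := by
  have : (atTop ⊓ 𝓟 {t | P t}).NeBot := frequently_mem_iff_neBot.1 hP
  obtain ⟨U, hU⟩ := Ultrafilter.exists_le (atTop ⊓ 𝓟 {t | P t})
  exact ⟨U, hU.trans inf_le_left, le_principal_iff.1 (hU.trans inf_le_right),
    isCompact_iff_ultrafilter_le_nhds.1 hK (U.map u)
      (tendsto_principal.2 (Eventually.of_forall hu))⟩

theorem exists_tendsto_of_finite_limits {X : Type*} [TopologicalSpace X] [T3Space X] {u : ℕ → X}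
    {K P : Set X} (hK : IsCompact K) (hu : ∀ t, u t ∈ K) (hP : P.Finite)
    (hlim : ∀ U : Ultrafilter ℕ, (U : Filter ℕ) ≤ atTop → ∀ a ∈ K, Tendsto u U (𝓝 a) →
      a ∈ P ∧ Tendsto (fun t => u (t + 1)) U (𝓝 a)) :
    ∃ a ∈ P, Tendsto u atTop (𝓝 a) := by
  obtain ⟨U, hU, -, a, haK, ha⟩ :=
    exists_ultrafilter_tendsto_of_frequently hK hu (Frequently.of_forall fun _ => trivial)
  refine ⟨a, (hlim U hU a haK ha).1, fun W hW => ?_⟩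
  have hisolated : (P \ {a})ᶜ ∈ 𝓝 a :=
    (hP.subset Set.sdiff_subset).isClosed.isOpen_compl.mem_nhds (by simp)
  obtain ⟨N, hN, hNclosed, hNW⟩ := exists_mem_nhds_isClosed_subset (inter_mem hW hisolated)
  by_contra hW_not
  -- Along the times at which `u` leaves `N` it still accumulates only at `a`, where the next term
  -- stays in `N`.
  have hin : ∃ᶠ t in atTop, u t ∈ N := (ha.eventually hN).frequently.filter_mono hU
  have hout : ∃ᶠ t in atTop, u t ∉ N := fun h =>
    hW_not (h.mono fun t ht => (hNW (not_not.1 ht)).1)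
  obtain ⟨U', hU', hleave, b, hbK, hb⟩ :=
    exists_ultrafilter_tendsto_of_frequently hK hu (frequently_and_not_succ hin hout)
  obtain ⟨hbP, hb'⟩ := hlim U' hU' b hbK hb
  have hbN : b ∈ N := hNclosed.mem_of_tendsto hb (hleave.mono fun t ht => ht.1)
  obtain rfl : b = a := not_not.1 fun hba => (hNW hbN).2 ⟨hbP, hba⟩
  obtain ⟨t, hin', -, hout'⟩ := ((hb'.eventually hN).and hleave).exists
  exact hout' hin'

end LimitPoints

section MonotoneIteration

variable {V ι α : Type*} [Fintype V] [DecidableEq V] {q : ℕ} {G : SimpleGraph V} {ν : ℝ}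
  {x : Fin q → V → ℝ} {l : Filter α} {θ' η : (V → ℝ) × Matrix V V ℝ}
  {f g h : α → (V → ℝ) × Matrix V V ℝ}

lemma emQ_le_emQ_self_of_tendsto [l.NeBot] (hν : 2 < ν) (hq : 0 < q) (hθ' : θ'.2.PosDef)
    (hη : η.2.PosDef) (hfp : ∀ t, (f t).2.PosDef) (hgp : ∀ t, (g t).2.PosDef)
    (hhp : ∀ t, (h t).2.PosDef) (hf : Tendsto f l (𝓝 θ')) (hh : Tendsto h l (𝓝 η))
    (hgap : Tendsto (fun t => logLik ν x (g t) - logLik ν x (f t)) l (𝓝 0))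
    (hle : ∀ᶠ t in l, emQ ν x (h t) (f t) ≤ emQ ν x (g t) (f t)) :
    emQ ν x η θ' ≤ emQ ν x θ' θ' := by
  rw [← sub_nonpos]
  refine le_of_tendsto_of_tendsto (tendsto_emQ_sub hν hq hθ' hη hfp hhp hf hh) hgap ?_
  filter_upwards [hle] with t ht
  exact (sub_le_sub_right ht _).trans (emQ_sub_le_logLik_sub hν x (hfp t) (hgp t))

lemma tendsto_of_isMomentUpdate [Finite ι] (F : CliqueForest G ι) (hν : 2 < ν) (hq : 0 < q)
    (hθ' : θ' ∈ params G) {a : α → V → ℝ} {a' : V → ℝ} (hf : Tendsto f l (𝓝 θ'))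
    (ha : Tendsto a l (𝓝 a')) (hagree : AgreeOn G θ'.2⁻¹ (emCov ν x θ' a'))
    (hupd : ∀ᶠ t in l, IsMomentUpdate G ν x (f t) (a t) (g t)) :
    Tendsto g l (𝓝 (emMean ν x θ', θ'.2)) := by
  cases nonempty_fintype ι
  have hpd := CliqueForest.block_posDef_of_agreeOn_inv (F := F) hθ'.1 hagree
  have hcov := (continuousAt_cliqueMinusSep (F := F) hpd).tendsto.comp
    (tendsto_emCov (x := x) hν hθ'.1 hf ha)
  rw [← CliqueForest.eq_cliqueMinusSep_of_agreeOn (emCov_isSymm ν x θ' a') hθ' hagree] at hcov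
  refine (((continuousAt_emMean hν hq hθ'.1).tendsto.comp hf).prodMk_nhds hcov).congr' ?_
  filter_upwards [hupd] with t ht
  exact Prod.ext ht.mean_eq.symm (CliqueForest.eq_cliqueMinusSep_of_agreeOn
    (emCov_isSymm ν x (f t) (a t)) ht.mem_params ht.agreeOn).symm

lemma IsMomentMatched.tendsto_of_isMomentUpdate [Finite ι] (F : CliqueForest G ι) (hν : 2 < ν)
    (hq : 0 < q) (hθ' : θ' ∈ params G) (hmatch : IsMomentMatched G ν x θ') {a : α → V → ℝ}
    (hf : Tendsto f l (𝓝 θ')) (ha : Tendsto a l (𝓝 θ'.1))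
    (hupd : ∀ᶠ t in l, IsMomentUpdate G ν x (f t) (a t) (g t)) : Tendsto g l (𝓝 θ') := by
  have hg := SparseStudent.tendsto_of_isMomentUpdate F hν hq hθ' hf ha hmatch.2 hupd
  rwa [← hmatch.1] at hg

variable [l.NeBot]

lemma isMomentMatched_of_tendsto_isEMStep (hν : 2 < ν) (hq : 0 < q) (hθ' : θ' ∈ params G)
    (hfp : ∀ t, f t ∈ params G) (hgp : ∀ t, g t ∈ params G) (hf : Tendsto f l (𝓝 θ'))
    (hgap : Tendsto (fun t => logLik ν x (g t) - logLik ν x (f t)) l (𝓝 0))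
    (hstep : ∀ᶠ t in l, IsEMStep G ν x (f t) (g t)) : IsMomentMatched G ν x θ' := by
  refine (isEMStep_self_iff hν hq hθ').1 ⟨hθ', fun η hη => ?_⟩
  exact emQ_le_emQ_self_of_tendsto hν hq hθ'.1 hη.1 (fun t => (hfp t).1) (fun t => (hgp t).1)
    (fun _ => hη.1) hf (tendsto_const_nhds (x := η)) hgap (hstep.mono fun _ ht => ht.2 η hη)

lemma agreeOn_of_tendsto_isSeparateEMStep (hν : 2 < ν) (hq : 0 < q) (hθ' : θ' ∈ params G)
    (hfp : ∀ t, f t ∈ params G) (hgp : ∀ t, g t ∈ params G) (hf : Tendsto f l (𝓝 θ'))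
    (hgap : Tendsto (fun t => logLik ν x (g t) - logLik ν x (f t)) l (𝓝 0))
    (hstep : ∀ᶠ t in l, IsSeparateEMStep G ν x (f t) (g t)) :
    AgreeOn G θ'.2⁻¹ (emCov ν x θ' θ'.1) := by
  refine (agreeOn_inv_emCov_iff hν hq hθ' hθ'.1).2 fun K hK => ?_
  refine emQ_le_emQ_self_of_tendsto (η := (θ'.1, K)) (h := fun t => ((f t).1, K)) hν hq hθ'.1 hK.1
    (fun t => (hfp t).1) (fun t => (hgp t).1) (fun _ => hK.1) hf
    (hf.fst_nhds.prodMk_nhds tendsto_const_nhds) hgap ?_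
  filter_upwards [hstep] with t ht
  exact (ht.2.2 (0, K) hK).trans (ht.2.1 _)

lemma isMomentMatched_of_tendsto_isSeparateEMStep [Finite ι] (F : CliqueForest G ι) (hν : 2 < ν)
    (hq : 0 < q) (hθ' : θ' ∈ params G) (hfp : ∀ t, f t ∈ params G) (hgp : ∀ t, g t ∈ params G)
    (hf : Tendsto f l (𝓝 θ'))
    (hgap : Tendsto (fun t => logLik ν x (g t) - logLik ν x (f t)) l (𝓝 0))
    (hstep : ∀ᶠ t in l, IsSeparateEMStep G ν x (f t) (g t)) : IsMomentMatched G ν x θ' := by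
  have hagree := agreeOn_of_tendsto_isSeparateEMStep hν hq hθ' hfp hgp hf hgap hstep
  have hg : Tendsto g l (𝓝 (emMean ν x θ', θ'.2)) :=
    tendsto_of_isMomentUpdate F hν hq hθ' hf hf.fst_nhds hagree
      (hstep.mono fun t ht => (isSeparateEMStep_iff hν hq (hfp t).1).1 ht)
  -- Moving the location to the weighted mean does not change the likelihood in the limit, although
  -- it strictly increases the E-step objective unless the location is already there.
  have hlogLik : logLik ν x (emMean ν x θ', θ'.2) - logLik ν x θ' = 0 :=
    tendsto_nhds_unique (((continuousAt_logLik hν x (θ := (emMean ν x θ', θ'.2)) hθ'.1).tendsto.comp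
      hg).sub ((continuousAt_logLik hν x hθ'.1).tendsto.comp hf)) hgap
  have hemQ := emQ_sub_le_logLik_sub hν x hθ'.1 (η := (emMean ν x θ', θ'.2)) hθ'.1
  exact ⟨eq_emMean_of_emQ_le hν hq hθ'.1 hθ'.1 (sub_nonpos.1 (hemQ.trans_eq hlogLik)), hagree⟩

end MonotoneIteration

section Sequence

variable {V ι : Type*} [Fintype V] [DecidableEq V] {q : ℕ} {G : SimpleGraph V} {ν : ℝ}
  {x : Fin q → V → ℝ} {θ : ℕ → (V → ℝ) × Matrix V V ℝ} {θ' : (V → ℝ) × Matrix V V ℝ}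
  {U : Ultrafilter ℕ}

lemma IsEMSequence.mem_params (h : IsEMSequence G ν x θ) (t : ℕ) : θ t ∈ params G := by
  cases t with
  | zero => exact h.1
  | succ t => exact (h.2 t).elim And.left And.left

lemma IsEMSequence.emQ_self_le (h : IsEMSequence G ν x θ) (t : ℕ) :
    emQ ν x (θ t) (θ t) ≤ emQ ν x (θ (t + 1)) (θ t) := by
  rcases h.2 t with hjoint | hsep
  · exact hjoint.2 _ (h.mem_params t)
  · exact (hsep.2.2 _ (h.mem_params t)).trans (hsep.2.1 _)

theorem IsEMSequence.monotone_logLik (hν : 2 < ν) (h : IsEMSequence G ν x θ) :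
    Monotone fun t => logLik ν x (θ t) :=
  monotone_nat_of_le_succ fun t => sub_nonneg.1 <| (sub_nonneg.2 (h.emQ_self_le t)).trans <|
    emQ_sub_le_logLik_sub hν x (h.mem_params t).1 (h.mem_params (t + 1)).1

lemma IsEMSequence.tendsto_logLik_sub (hν : 2 < ν) (h : IsEMSequence G ν x θ) {l : Filter ℕ}
    [l.NeBot] (hl : l ≤ atTop) (hθ' : θ'.2.PosDef) (hlim : Tendsto θ l (𝓝 θ')) :
    Tendsto (fun t => logLik ν x (θ (t + 1)) - logLik ν x (θ t)) l (𝓝 0) := by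
  have hlogLik : Tendsto (fun t => logLik ν x (θ t)) atTop (𝓝 (logLik ν x θ')) :=
    tendsto_atTop_of_monotone_of_le (h.monotone_logLik hν) hl
      ((continuousAt_logLik hν x hθ').tendsto.comp hlim)
  rw [← sub_self (logLik ν x θ')]
  exact ((hlogLik.comp (tendsto_add_atTop_nat 1)).sub hlogLik).mono_left hl

lemma IsEMSequence.eventually_step_or (h : IsEMSequence G ν x θ) (U : Ultrafilter ℕ) :
    (∀ᶠ t in U, IsEMStep G ν x (θ t) (θ (t + 1))) ∨
      ∀ᶠ t in U, IsSeparateEMStep G ν x (θ t) (θ (t + 1)) :=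
  U.eventually_or.1 (Eventually.of_forall h.2)

theorem IsEMSequence.isMomentMatched_of_tendsto [Finite ι] (F : CliqueForest G ι) (hν : 2 < ν)
    (hq : 0 < q) (h : IsEMSequence G ν x θ) (hU : (U : Filter ℕ) ≤ atTop) (hθ' : θ' ∈ params G)
    (hlim : Tendsto θ U (𝓝 θ')) : IsMomentMatched G ν x θ' := by
  have hmem := h.mem_params
  have hgap := h.tendsto_logLik_sub hν hU hθ'.1 hlim
  rcases h.eventually_step_or U with hjoint | hsep
  · exact isMomentMatched_of_tendsto_isEMStep hν hq hθ' hmem (fun t => hmem (t + 1)) hlim hgap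
      hjoint
  · exact isMomentMatched_of_tendsto_isSeparateEMStep F hν hq hθ' hmem (fun t => hmem (t + 1))
      hlim hgap hsep

theorem IsEMSequence.tendsto_succ [Finite ι] (F : CliqueForest G ι) (hν : 2 < ν) (hq : 0 < q)
    (h : IsEMSequence G ν x θ) (hθ' : θ' ∈ params G) (hmatch : IsMomentMatched G ν x θ')
    (hlim : Tendsto θ U (𝓝 θ')) : Tendsto (fun t => θ (t + 1)) U (𝓝 θ') := by
  rcases h.eventually_step_or U with hjoint | hsep
  · have hmean := (continuousAt_emMean (x := x) hν hq hθ'.1).tendsto.comp hlim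
    rw [← hmatch.1] at hmean
    exact hmatch.tendsto_of_isMomentUpdate F hν hq hθ' hlim hmean
      (hjoint.mono fun t ht => (isEMStep_iff hν hq (h.mem_params t).1).1 ht)
  · exact hmatch.tendsto_of_isMomentUpdate F hν hq hθ' hlim hlim.fst_nhds
      (hsep.mono fun t ht => (isSeparateEMStep_iff hν hq (h.mem_params t).1).1 ht)

variable [Fintype ι]

theorem IsEMSequence.solvesEquations_of_mapClusterPt (F : CliqueForest G ι) (hν : 2 < ν)
    (hq : 0 < q) (h : IsEMSequence G ν x θ) (hθ' : θ' ∈ params G)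
    (hcluster : MapClusterPt θ' atTop θ) : SolvesEquations F ν x θ' := by
  obtain ⟨U, hU, hlim⟩ := mapClusterPt_iff_ultrafilter.1 hcluster
  exact (solvesEquations_iff F hθ').2 (h.isMomentMatched_of_tendsto F hν hq hU hθ' hlim)

lemma IsEMSequence.tendsto_emWeight (hν : 2 < ν) (h : IsEMSequence G ν x θ)
    (hθ' : θ'.2.PosDef) (hlim : Tendsto θ atTop (𝓝 θ')) (y : V → ℝ) :
    Tendsto (fun t => emWeight ν (θ t) y) atTop (𝓝 (studentWeight ν θ' y)) := by
  simp only [emWeight_eq hν (h.mem_params _).1]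
  exact (continuousAt_studentWeight hν hθ' y).tendsto.comp hlim

theorem IsEMSequence.exists_tendsto_of_isCompact (F : CliqueForest G ι) (hν : 2 < ν)
    (hq : 0 < q) (h : IsEMSequence G ν x θ) {K : Set ((V → ℝ) × Matrix V V ℝ)}
    (hKG : K ⊆ params G) (hK : IsCompact K) (hmem : ∀ t, θ t ∈ K)
    (hfin : {θ' ∈ K | SolvesEquations F ν x θ'}.Finite) :
    ∃ θ' ∈ K, SolvesEquations F ν x θ' ∧ Tendsto θ atTop (𝓝 θ') := by
  have : T3Space (Matrix V V ℝ) := inferInstanceAs (T3Space (V → V → ℝ))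
  obtain ⟨θ', ⟨hθ'K, hsol⟩, hlim⟩ := exists_tendsto_of_finite_limits hK hmem hfin
    fun U hU a haK ha => by
      have hmatch := h.isMomentMatched_of_tendsto F hν hq hU (hKG haK) ha
      exact ⟨⟨haK, (solvesEquations_iff F (hKG haK)).2 hmatch⟩,
        h.tendsto_succ F hν hq (hKG haK) hmatch ha⟩
  exact ⟨θ', hθ'K, hsol, hlim⟩

end Sequence

end SparseStudent

end

open SparseStudent in
theorem mainTheorem2 {V ι : Type*} [Fintype V] [DecidableEq V] [Fintype ι]
    (G : SimpleGraph V) (F : CliqueForest G ι) (ν : ℝ) (hν : 2 < ν)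
    {q : ℕ} (hq : 0 < q) (x : Fin q → V → ℝ) :
    -- the maximum likelihood solution has the clique-minus-separator form, and is an EM fixed point
    (∀ θ, IsMLSolution G ν x θ →
      SolvesEquations F ν x θ ∧ IsEMStep G ν x θ θ ∧ IsSeparateEMStep G ν x θ θ) ∧
    -- the weights are the EM weights
    (∀ θ ∈ params G, ∀ y, emWeight ν θ y = studentWeight ν θ y) ∧
    -- the equations characterize the stationary points and the EM fixed points
    (∀ θ ∈ params G,
      (IsStationary G ν x θ ↔ SolvesEquations F ν x θ) ∧
      (IsEMStep G ν x θ θ ↔ SolvesEquations F ν x θ) ∧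
      (IsSeparateEMStep G ν x θ θ ↔ SolvesEquations F ν x θ)) ∧
    -- the EM updates exist, are unique and are explicit when the clique sample covariances
    -- are positive definite
    ((∀ k, (block (weightedCov 1 x (weightedMean 1 x)) (F.C k)).PosDef) →
      ∀ θ ∈ params G, ∀ m, m = weightedMean (fun s => studentWeight ν θ (x s)) x →
        (∀ θ', IsEMStep G ν x θ θ' ↔ θ' = (m, cliqueMinusSep F (emCov ν x θ m))) ∧
        (∀ θ', IsSeparateEMStep G ν x θ θ' ↔ θ' = (m, cliqueMinusSep F (emCov ν x θ θ.1)))) ∧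
    -- behaviour of the EM iteration
    (∀ θ : ℕ → (V → ℝ) × Matrix V V ℝ, IsEMSequence G ν x θ →
      Monotone (fun t => logLik ν x (θ t)) ∧
      (∀ θ' ∈ params G, MapClusterPt θ' Filter.atTop θ → SolvesEquations F ν x θ') ∧
      (∀ θ' ∈ params G, Filter.Tendsto θ Filter.atTop (nhds θ') →
        SolvesEquations F ν x θ' ∧
        ∀ s, Filter.Tendsto (fun t => emWeight ν (θ t) (x s)) Filter.atTop
          (nhds (studentWeight ν θ' (x s)))) ∧
      (∀ K ⊆ params G, IsCompact K → (∀ t, θ t ∈ K) →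
        {θ' ∈ K | SolvesEquations F ν x θ'}.Finite →
        ∃ θ' ∈ K, SolvesEquations F ν x θ' ∧ Filter.Tendsto θ Filter.atTop (nhds θ'))) := by
  refine ⟨fun θ hML => ?_, fun θ hθ y => emWeight_eq hν hθ.1 y, fun θ hθ => ?_,
    fun hpd θ hθ m hm => ?_, fun θ hEM => ?_⟩
  · have hstep := hML.isEMStep_self hν
    have hmatch := (isEMStep_self_iff hν hq hML.1).1 hstep
    exact ⟨(solvesEquations_iff F hML.1).2 hmatch, hstep,
      (isSeparateEMStep_self_iff hν hq hML.1).2 hmatch⟩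
  · rw [solvesEquations_iff F hθ]
    exact ⟨isStationary_iff hν hq hθ, isEMStep_self_iff hν hq hθ,
      isSeparateEMStep_self_iff hν hq hθ⟩
  · obtain rfl : m = emMean ν x θ := hm
    have hblock (a : V → ℝ) (k : ι) := block_emCov_posDef hν hq hθ.1 (hpd k) a
    exact ⟨fun _ => (isEMStep_iff hν hq hθ.1).trans (isMomentUpdate_iff_eq F (hblock _)),
      fun _ => (isSeparateEMStep_iff hν hq hθ.1).trans (isMomentUpdate_iff_eq F (hblock _))⟩
  · have hsolve {θ'} (hθ' : θ' ∈ params G) := hEM.solvesEquations_of_mapClusterPt F hν hq hθ'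
    exact ⟨hEM.monotone_logLik hν, fun _ hθ' => hsolve hθ',
      fun _ hθ' hlim => ⟨hsolve hθ' hlim.mapClusterPt,
        fun s => hEM.tendsto_emWeight hν hθ'.1 hlim (x s)⟩,
      fun _ hKG hK hmem hfin => hEM.exists_tendsto_of_isCompact F hν hq hKG hK hmem hfin⟩
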